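/- Let $n\ge 2$, let $A=(a_{ij})$ be an $n\times n$ matrix of non-negative integers all of whose row sums and column sums are equal to $n$, assume that $A$ is invertible over $\mathbf Q$, and let $t\in\mathbf C$. Let $d$ be the smallest positive integer such that $B=(b_{ij}):=dA^{-1}$ has integer entries, and let $m:=d/n$ (an integer). All varieties are over $\mathbf C$, considered as zero loci with the Zariski topology and their sheaves of regular functions (they may be reducible). Let $$X_{A,t}=Z\Big(\sum_{i=1}^n\prod_{j=1}^n x_j^{a_{ij}}-nt\prod_{j=1}^n x_j\Big),\qquad X_{dI,t}=Z\Big(\sum_{j=1}^n y_j^d-nt\Big(\prod_{j=1}^n y_j\Big)^m\Big)\qquad\text{in }\mathbf P^{n-1},$$ $$\overline M_t=Z\big(z_1+\cdots+z_n-ntz_0,\; z_0^n-z_1\cdots z_n\big)\subset\mathbf P^n,$$ and consider the rational maps $$\varphi_{A,t}:X_{dI,t}\dashrightarrow X_{A,t},\quad x_j=\prod_{k=1}^n y_k^{b_{jk}},\qquad q_{A,t}:X_{A,t}\dashrightarrow\overline M_t,\quad z_0=\prod_{j=1}^n x_j,\; z_i=\prod_{j=1}^n x_j^{a_{ij}}\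 (1\le i\le n).$$ Let $\zeta=e^{2\pi i/d}$ and, for $a\in(\mathbf Z/d)^n$, let $g_a$ be the automorphism $(y_1:\dots:y_n)\mapsto(\zeta^{a_1}y_1:\dots:\zeta^{a_n}y_n)$ of $\mathbf P^{n-1}$. Let $$\Gamma_d=\{a\in(\mathbf Z/d)^n: a_1+\cdots+a_n\equiv 0 \bmod n\}/\langle(1,\dots,1)\rangle .$$ For rational maps $f_i:X\dashrightarrow Y_i$ ($i=1,2$), say that $f_1$ and $f_2$ are birationally equivalent if there are dense Zariski open subsets $U\subset X$, on which both maps are defined, and $U_i\subset Y_i$, with an isomorphism $\psi:U_1\to U_2$ such that $\psi\circ f_1=f_2$ on $U$. For a finite group $G$ of automorphisms of $X$, say that $f:X\dashrightarrow Y$ is birationally the quotient by $G$ if $f$ is birationally equivalent to the quotient map $X\to X/G$, where $X/G$ is the orbit space with the quotient topology and with the $G$-invariant regular functions on the preimages of its open sets as regular functions. Assume that $X_{A,t}$ is irreducible. Then: 1. $a\mapsto g_a$ defines an injective homomorphism $\Gamma_d\to\mathrm{Aut}(X_{dI,t})$, and $a\mapsto g_{Ba}$ defines a homomorphism $\rho:\Gamma_d\to\mathrm{Aut}(X_{A,t})$.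 Put $\Gamma_A:=\ker\rho$ and $H_A:=\rho(\Gamma_d)$, so that $H_A\cong\Gamma_d/\Gamma_A$. 2. $\varphi_{A,t}:X_{dI,t}\dashrightarrow X_{A,t}$ is birationally the quotient by $\Gamma_A$. 3. $q_{A,t}:X_{A,t}\dashrightarrow\overline M_t$ is birationally the quotient by $H_A$. 4. $q_{A,t}\circ\varphi_{A,t}:X_{dI,t}\dashrightarrow\overline M_t$ is birationally the quotient by $\Gamma_d$. 5. $\Gamma_d\cong\mu_m\times\mu_d^{\,n-2}$, where $\mu_k$ is the group of $k$-th roots of unity in $\mathbf C$. -/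

import Mathlib

open MvPolynomial Topology Filter
open scoped LinearAlgebra.Projectivization

/-! ## Spaces with functions

Complex varieties are treated classically: a variety is the set of its closed points with the
Zariski topology and its sheaf of regular `ℂ`-valued functions. A sheaf of functions is recorded
by saying which functions are regular at which points. -/

/-- A sheaf of `ℂ`-algebras of `ℂ`-valued functions on a topological space `X`: `RegularAt f x` says
that `f` restricts to a section of the sheaf on some open neighbourhood of `x`. -/
class FunctionSheaf (X : Type) [TopologicalSpace X] where
  RegularAt : (X → ℂ) → X → Prop
  congr : ∀ {f g : X → ℂ} {x : X}, f =ᶠ[𝓝 x] g → RegularAt f x → RegularAt g x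
  eventually : ∀ {f : X → ℂ} {x : X}, RegularAt f x → ∀ᶠ y in 𝓝 x, RegularAt f y
  const : ∀ (c : ℂ) (x : X), RegularAt (fun _ => c) x
  add : ∀ {f g : X → ℂ} {x : X}, RegularAt f x → RegularAt g x →
    RegularAt (fun y => f y + g y) x
  mul : ∀ {f g : X → ℂ} {x : X}, RegularAt f x → RegularAt g x →
    RegularAt (fun y => f y * g y) x

open FunctionSheaf (RegularAt)

/-- An isomorphism of spaces with functions: a homeomorphism which identifies the regular
functions. -/
def IsIsomorphism {X Y : Type} [TopologicalSpace X] [FunctionSheaf X] [TopologicalSpace Y]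
    [FunctionSheaf Y] (e : X ≃ Y) : Prop :=
  Continuous e ∧ Continuous e.symm ∧
    ∀ (f : Y → ℂ) (x : X), RegularAt f (e x) ↔ RegularAt (fun x' => f (e x')) x

/-- The automorphism group of a space with functions. -/
def Aut (X : Type) [TopologicalSpace X] [FunctionSheaf X] : Subgroup (Equiv.Perm X) where
  carrier := {e | IsIsomorphism e}
  one_mem' := ⟨continuous_id, continuous_id, fun _ _ => Iff.rfl⟩
  mul_mem' := by
    rintro a b ⟨ha, ha', hf⟩ ⟨hb, hb', hg⟩
    refine ⟨ha.comp hb, hb'.comp ha', fun f x => ?_⟩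
    exact (hf f (b x)).trans (hg (fun x' => f (a x')) x)
  inv_mem' := by
    rintro a ⟨ha, ha', hf⟩
    refine ⟨ha', ha, fun f x => ?_⟩
    have h := hf (fun x' => f (a.symm x')) (a.symm x)
    simp only [Equiv.symm_apply_apply, Equiv.apply_symm_apply] at h
    exact h.symm

/-- The induced structure on a subset: a function on `S` is regular at a point if near that point
it is the restriction of a regular function of the ambient space. It is used for closed
subvarieties of projective space and for open subsets. -/
instance Subtype.functionSheaf {X : Type} [TopologicalSpace X] [FunctionSheaf X] (S : Set X) :
    FunctionSheaf S where
  RegularAt f x := ∃ g : X → ℂ, RegularAt g (x : X) ∧ f =ᶠ[𝓝 x] fun y => g y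
  congr := by
    rintro f f' x h ⟨g, hg, hfg⟩
    exact ⟨g, hg, h.symm.trans hfg⟩
  eventually := by
    rintro f x ⟨g, hg, hfg⟩
    have h := continuous_subtype_val.continuousAt.eventually (FunctionSheaf.eventually hg)
    filter_upwards [h, hfg.eventuallyEq_nhds] with y hy hy'
    exact ⟨g, hy, hy'⟩
  const c x := ⟨fun _ => c, FunctionSheaf.const c _, EventuallyEq.rfl⟩
  add := by
    rintro f f' x ⟨g, hg, hfg⟩ ⟨g', hg', hfg'⟩
    exact ⟨_, FunctionSheaf.add hg hg', hfg.add hfg'⟩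
  mul := by
    rintro f f' x ⟨g, hg, hfg⟩ ⟨g', hg', hfg'⟩
    exact ⟨_, FunctionSheaf.mul hg hg', hfg.mul hfg'⟩

/-- The quotient `X / G` of `X` by a group `G`: the set of orbits, with the structure below. -/
abbrev OrbitSpace (G X : Type) [Group G] [MulAction G X] : Type :=
  MulAction.orbitRel.Quotient G X

/-- The quotient map `X → X / G`. -/
def orbitMap (G X : Type) [Group G] [MulAction G X] : X → OrbitSpace G X :=
  Quotient.mk _

/-- The quotient topology. -/
instance OrbitSpace.topology (G X : Type) [Group G] [MulAction G X] [TopologicalSpace X] :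
    TopologicalSpace (OrbitSpace G X) :=
  TopologicalSpace.coinduced (orbitMap G X) inferInstance

theorem continuous_orbitMap (G X : Type) [Group G] [MulAction G X] [TopologicalSpace X] :
    Continuous (orbitMap G X) := continuous_coinduced_rng

/-- The regular functions on an open subset `W` of `X / G` are the functions whose pull-backs to the
preimage of `W` in `X` are regular, that is, the `G`-invariant regular functions on the preimage. -/
instance OrbitSpace.functionSheaf (G X : Type) [Group G] [MulAction G X] [TopologicalSpace X]
    [FunctionSheaf X] : FunctionSheaf (OrbitSpace G X) where
  RegularAt f q := ∀ᶠ q' in 𝓝 q, ∀ x : X, orbitMap G X x = q' →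
    RegularAt (fun y => f (orbitMap G X y)) x
  congr := by
    intro f g q h hf
    filter_upwards [h.eventuallyEq_nhds, hf] with q' h' hf' x hx
    refine FunctionSheaf.congr ?_ (hf' x hx)
    subst hx
    exact (continuous_orbitMap G X).continuousAt.eventually h'
  eventually := fun h => h.eventually_nhds
  const c q := Eventually.of_forall fun _ x _ => FunctionSheaf.const c x
  add := by
    intro f g q hf hg
    filter_upwards [hf, hg] with q' hf' hg' x hx
    exact FunctionSheaf.add (hf' x hx) (hg' x hx)
  mul := by
    intro f g q hf hg
    filter_upwards [hf, hg] with q' hf' hg' x hx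
    exact FunctionSheaf.mul (hf' x hx) (hg' x hx)

/-! ## Rational maps

A rational map is given by a partially defined map; it is determined by its values on any dense
open subset. -/

/-- Two rational maps `f₁ : X ⇢ Y₁` and `f₂ : X ⇢ Y₂` are birationally equivalent if there are dense
open subsets `U ⊆ X` (on which both are defined) and `U₁ ⊆ Y₁`, `U₂ ⊆ Y₂` and an isomorphism
`ψ : U₁ → U₂` such that `ψ ∘ f₁ = f₂` on `U`. -/
def BirationallyEquivalent {X Y₁ Y₂ : Type} [TopologicalSpace X]
    [TopologicalSpace Y₁] [FunctionSheaf Y₁] [TopologicalSpace Y₂] [FunctionSheaf Y₂]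
    (f₁ : X →. Y₁) (f₂ : X →. Y₂) : Prop :=
  ∃ (U : Set X) (U₁ : Set Y₁) (U₂ : Set Y₂) (ψ : U₁ ≃ U₂),
    IsOpen U ∧ Dense U ∧ IsOpen U₁ ∧ Dense U₁ ∧ IsOpen U₂ ∧ Dense U₂ ∧ IsIsomorphism ψ ∧
    ∀ x ∈ U, ∃ y₁ : U₁, (y₁ : Y₁) ∈ f₁ x ∧ (ψ y₁ : Y₂) ∈ f₂ x

/-- `f : X ⇢ Y` is birational to the quotient map `X → X / G`, for a group `G` of automorphisms
of `X`. -/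
def BirationalToQuotient {X Y : Type} [TopologicalSpace X] [FunctionSheaf X]
    [TopologicalSpace Y] [FunctionSheaf Y] (f : X →. Y) (G : Subgroup (Aut X)) : Prop :=
  BirationallyEquivalent f (PFun.lift (orbitMap G X))

/-! ## Projective space and its subvarieties -/

/-- The complex projective space with homogeneous coordinates indexed by `Fin n`, so of dimension
`n - 1`. -/
abbrev PSpace (n : ℕ) : Type := ℙ ℂ (Fin n → ℂ)

/-- The Zariski topology: generated by the sets where a homogeneous polynomial does not vanish. -/
instance PSpace.zariskiTopology (n : ℕ) : TopologicalSpace (PSpace n) :=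
  TopologicalSpace.generateFrom
    {U | ∃ (F : MvPolynomial (Fin n) ℂ) (k : ℕ), F.IsHomogeneous k ∧
      U = {p : PSpace n | eval p.rep F ≠ 0}}

/-- A function on projective space is regular at `p` if on a neighbourhood of `p` it is a quotient
`g / h` of homogeneous polynomials of the same degree, with `h` nowhere zero there. -/
noncomputable instance PSpace.functionSheaf (n : ℕ) : FunctionSheaf (PSpace n) where
  RegularAt f p := ∃ (k : ℕ) (g h : MvPolynomial (Fin n) ℂ),
    g.IsHomogeneous k ∧ h.IsHomogeneous k ∧
    ∀ᶠ q : PSpace n in 𝓝 p, eval q.rep h ≠ 0 ∧ f q = eval q.rep g / eval q.rep h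
  congr := by
    rintro f f' p hff ⟨k, g, h, hg, hh, H⟩
    refine ⟨k, g, h, hg, hh, ?_⟩
    filter_upwards [hff, H] with q h₁ h₂
    exact ⟨h₂.1, h₁.symm.trans h₂.2⟩
  eventually := by
    rintro f p ⟨k, g, h, hg, hh, H⟩
    filter_upwards [H.eventually_nhds] with q hq
    exact ⟨k, g, h, hg, hh, hq⟩
  const c p := ⟨0, C c, 1, isHomogeneous_C _ _, isHomogeneous_one _ _,
    Eventually.of_forall fun q => by simp⟩
  add := by
    rintro f f' p ⟨k, g, h, hg, hh, H⟩ ⟨k', g', h', hg', hh', H'⟩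
    refine ⟨k + k', g * h' + h * g', h * h', (hg.mul hh').add (hh.mul hg'), hh.mul hh', ?_⟩
    filter_upwards [H, H'] with q h₁ h₂
    refine ⟨by simpa using ⟨h₁.1, h₂.1⟩, ?_⟩
    have e₁ := h₁.1
    have e₂ := h₂.1
    rw [h₁.2, h₂.2, map_add, map_mul, map_mul, map_mul, div_add_div _ _ e₁ e₂]
  mul := by
    rintro f f' p ⟨k, g, h, hg, hh, H⟩ ⟨k', g', h', hg', hh', H'⟩
    refine ⟨k + k', g * g', h * h', hg.mul hg', hh.mul hh', ?_⟩
    filter_upwards [H, H'] with q h₁ h₂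
    refine ⟨by simpa using ⟨h₁.1, h₂.1⟩, ?_⟩
    rw [h₁.2, h₂.2, map_mul, map_mul, div_mul_div_comm]

/-- The common zero locus in projective space of a set of homogeneous polynomials. -/
def projZeros {n : ℕ} (S : Set (MvPolynomial (Fin n) ℂ)) : Set (PSpace n) :=
  {p | ∀ F ∈ S, eval p.rep F = 0}

/-- The partial map `[v] ↦ [φ(v)]` between subsets of projective spaces, where `φ` is homogeneous:
it is defined at the points `[v]` such that `v ∈ D`, `φ(v) ≠ 0` and `[φ(v)]` lies in `Y`. -/
noncomputable def coordMap {n k : ℕ} (X : Set (PSpace n)) (Y : Set (PSpace k)) (D : Set (Fin n → ℂ))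
    (φ : (Fin n → ℂ) → (Fin k → ℂ)) : X →. Y := fun p =>
  { Dom := p.1.rep ∈ D ∧ ∃ h : φ p.1.rep ≠ 0, Projectivization.mk ℂ (φ p.1.rep) h ∈ Y
    get := fun H => ⟨Projectivization.mk ℂ (φ p.1.rep) H.2.choose, H.2.choose_spec⟩ }

/-- The automorphism `(y₁ : … : yₙ) ↦ (c₁ y₁ : … : cₙ yₙ)` of projective space. -/
noncomputable def diagMap {n : ℕ} (c : Fin n → ℂˣ) : PSpace n → PSpace n :=
  Projectivization.map
    (LinearEquiv.piCongrRight fun i => LinearEquiv.smulOfUnit (M := ℂ) (c i)).toLinearMap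
    (LinearEquiv.piCongrRight fun i => LinearEquiv.smulOfUnit (M := ℂ) (c i)).injective

/-! ## The varieties and the maps attached to a matrix -/

namespace Shioda

variable {n : ℕ}

/-- `A` viewed as a rational matrix. -/
def ratMatrix (A : Matrix (Fin n) (Fin n) ℕ) : Matrix (Fin n) (Fin n) ℚ :=
  A.map (fun a => (a : ℚ))

/-- The smallest positive integer `d` such that `d A⁻¹` has integer entries. -/
noncomputable def dNum (A : Matrix (Fin n) (Fin n) ℕ) : ℕ :=
  sInf {d : ℕ | 0 < d ∧ ∀ i j, ∃ b : ℤ, (d : ℚ) * (ratMatrix A)⁻¹ i j = (b : ℚ)}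

/-- The integer `m = d / n`. -/
noncomputable def mNum (A : Matrix (Fin n) (Fin n) ℕ) : ℕ := dNum A / n

/-- The integer matrix `B = d A⁻¹` (an integral rational number equals its numerator). -/
noncomputable def matB (A : Matrix (Fin n) (Fin n) ℕ) : Matrix (Fin n) (Fin n) ℤ :=
  fun i j => ((dNum A : ℚ) * (ratMatrix A)⁻¹ i j).num

/-- `F_{A,t} = ∑ᵢ ∏ⱼ xⱼ ^ aᵢⱼ - n t ∏ⱼ xⱼ`. -/
noncomputable def polyA (A : Matrix (Fin n) (Fin n) ℕ) (t : ℂ) : MvPolynomial (Fin n) ℂ :=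
  ∑ i, ∏ j, X j ^ A i j - C (n * t) * ∏ j, X j

/-- `X_{A,t}`, the zero locus of `F_{A,t}`. -/
def varA (A : Matrix (Fin n) (Fin n) ℕ) (t : ℂ) : Set (PSpace n) :=
  projZeros {polyA A t}

/-- `F_{dI,t} = ∑ⱼ yⱼ ^ d - n t (∏ⱼ yⱼ) ^ m`. -/
noncomputable def polyD (A : Matrix (Fin n) (Fin n) ℕ) (t : ℂ) : MvPolynomial (Fin n) ℂ :=
  ∑ j, X j ^ dNum A - C (n * t) * (∏ j, X j) ^ mNum A

/-- `X_{dI,t}`, the zero locus of `F_{dI,t}`. -/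
def varD (A : Matrix (Fin n) (Fin n) ℕ) (t : ℂ) : Set (PSpace n) :=
  projZeros {polyD A t}

/-- `M̄_t`, the zero locus of `z₁ + … + zₙ - n t z₀` and `z₀ ^ n - z₁ ⋯ zₙ`. -/
def mirror (n : ℕ) (t : ℂ) : Set (PSpace (n + 1)) :=
  projZeros {∑ i : Fin n, X i.succ - C (n * t) * X 0, X 0 ^ n - ∏ i : Fin n, X i.succ}

/-- The generalized Shioda map `φ_{A,t} : X_{dI,t} ⇢ X_{A,t}`, `xⱼ = ∏ₖ yₖ ^ bⱼₖ`. As exponents may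
be negative, the formula is used where all the `yₖ` are nonzero. -/
noncomputable def shiodaMap (A : Matrix (Fin n) (Fin n) ℕ) (t : ℂ) : varD A t →. varA A t :=
  coordMap (varD A t) (varA A t) {y | ∀ k, y k ≠ 0} fun y j => ∏ k, y k ^ matB A j k

/-- The rational map `q_{A,t} : X_{A,t} ⇢ M̄_t`, `z₀ = ∏ⱼ xⱼ`, `zᵢ = ∏ⱼ xⱼ ^ aᵢⱼ`. -/
noncomputable def mirrorMap (A : Matrix (Fin n) (Fin n) ℕ) (t : ℂ) : varA A t →. mirror n t :=
  coordMap (varA A t) (mirror n t) Set.univ fun x =>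
    Fin.cons (∏ j, x j) fun i => ∏ j, x j ^ A i j

/-! ## The groups -/

/-- The primitive `d`-th root of unity `ζ = exp(2πi/d)` in `ℂ`. -/
noncomputable def zeta (d : ℕ) : ℂˣ :=
  Units.mk0 (Complex.exp (2 * Real.pi * Complex.I / d)) (Complex.exp_ne_zero _)

/-- The automorphism `g_a : (y₁ : … : yₙ) ↦ (ζ ^ a₁ y₁ : … : ζ ^ aₙ yₙ)`, for `a ∈ (ℤ/d)ⁿ`. -/
noncomputable def gMap {d : ℕ} (a : Fin n → ZMod d) : PSpace n → PSpace n :=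
  diagMap fun i => zeta d ^ (a i).val

/-- `{a ∈ (ℤ/d)ⁿ : a₁ + … + aₙ ≡ 0 mod n}` (where `n` divides `d`). -/
def sumZero (n d : ℕ) : AddSubgroup (Fin n → ZMod d) where
  carrier := {a | (n : ZMod d) ∣ ∑ i, a i}
  zero_mem' := by simp
  add_mem' := by
    intro a b ha hb
    simp only [Set.mem_ofPred_eq, Pi.add_apply, Finset.sum_add_distrib] at *
    exact dvd_add ha hb
  neg_mem' := by
    intro a ha
    simpa using ha

/-- The group `Γ_d = {a : a₁ + … + aₙ ≡ 0 mod n} / ⟨(1, …, 1)⟩`, written multiplicatively. -/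
abbrev Gam (n d : ℕ) : Type :=
  Multiplicative
    (sumZero n d ⧸ (AddSubgroup.zmultiples (fun _ : Fin n => (1 : ZMod d))).addSubgroupOf
      (sumZero n d))

/-- The class of `g_a` in `Γ_d`. -/
def Gam.mk {n d : ℕ} (a : sumZero n d) : Gam n d :=
  Multiplicative.ofAdd (QuotientAddGroup.mk a)

/-- The vector `B a ∈ (ℤ/d)ⁿ`. -/
noncomputable def bMul (A : Matrix (Fin n) (Fin n) ℕ) (a : Fin n → ZMod (dNum A)) :
    Fin n → ZMod (dNum A) :=
  ((matB A).map (fun b => (b : ZMod (dNum A)))).mulVec a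

end Shioda

/-!
The three maps are monomial maps `y ↦ y ^ M` with all row sums of `M` equal to some `s ≠ 0`: `M = B`
for `φ_A`, `M = (1; A)` for `q_A`, and `M = (m; d I)` for `q_A ∘ φ_A`, where `n m = d`,
`A B = B A = d I` and all row and column sums of `B` are `m`. The proof restricts everything to the
points whose homogeneous coordinates are all nonzero.

There a monomial map is a homomorphism of tori with kernel `K = {c | c ^ M = 1}`, and its fibres are
the `K`-orbits, since a scalar can be absorbed by an `s`-th root
(`Shioda.torusPt_monMap_eq_iff`). For `(m; d I)` the kernel is `{ζ ^ a : ∑ aᵢ ≡ 0 mod n}`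
(`Shioda.monMap_compMatrix_eq_one_iff`); the kernels of the other two maps follow, because
`y ↦ y ^ B` is surjective on tori. So the fibres are the orbits of `Γ_d`, `Γ_A` and `H_A`.

That a set-theoretic quotient map is a quotient map of spaces with functions is the content of
`Shioda.birationalToQuotient_monMap`. A homogeneous Laurent polynomial `h(y)` is a finite sum of
terms `y ^ e P_e(y ^ M)`, where `e` runs through representatives of the classes of exponents modulo
the row lattice of `M` (`Shioda.IsLaurent.exists_descent`). The monomials `y ^ e` restrict to
distinct characters of `K`, as characters separate the points of a finitely generated abelian group, and
are thus linearly independent on `K` (`Shioda.eq_zero_of_sum_mon_out_eq_zero`). Hence `h` vanishes on a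
`K`-orbit if and only if all `P_e` vanish at its image: the map is open. If `F(y ^ M) h(y) = g(y)`
with `g = ∑ y ^ e Q_e(y ^ M)`, then `F P_e = Q_e` for every `e`: a function whose pull-back is
regular is itself regular.

The points with nonzero coordinates are dense in `X_{dI,t}` by the Nullstellensatz, because no
variable divides its equation (`Shioda.dense_torus_projZeros`); in `M̄_t` because `q_A ∘ φ_A`
extends to a surjective morphism `X_{dI,t} → M̄_t`; and in `X_{A,t}` because it is
irreducible and contains such points.
-/

namespace Shioda

/-! ### The Zariski topology and regular functions on projective sets -/

theorem eval_smul_of_isHomogeneous {n k : ℕ} {F : MvPolynomial (Fin n) ℂ} (hF : F.IsHomogeneous k)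
    (c : ℂ) (v : Fin n → ℂ) : eval (c • v) F = c ^ k * eval v F := by
  simp only [eval_eq', Finset.mul_sum, Pi.smul_apply, smul_eq_mul, mul_pow, Finset.prod_mul_distrib,
    Finset.prod_pow_eq_pow_sum]
  refine Finset.sum_congr rfl fun d hd => ?_
  have h := hF (mem_support_iff.1 hd)
  rw [Finsupp.weight_apply, Finsupp.sum_fintype _ _ (by simp)] at h
  simp only [Pi.one_apply, smul_eq_mul, mul_one] at h
  rw [h]
  ring

theorem exists_rep_eq_smul {n : ℕ} {v : Fin n → ℂ} (hv : v ≠ 0) :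
    ∃ c : ℂ, c ≠ 0 ∧ (Projectivization.mk ℂ v hv).rep = c • v := by
  obtain ⟨a, ha⟩ := Projectivization.exists_smul_eq_mk_rep ℂ v hv
  exact ⟨a, a.ne_zero, ha.symm⟩

theorem eval_rep_mk_eq_zero_iff {n k : ℕ} {F : MvPolynomial (Fin n) ℂ} (hF : F.IsHomogeneous k)
    {v : Fin n → ℂ} (hv : v ≠ 0) :
    eval (Projectivization.mk ℂ v hv).rep F = 0 ↔ eval v F = 0 := by
  obtain ⟨c, hc, h⟩ := exists_rep_eq_smul hv
  rw [h, eval_smul_of_isHomogeneous hF]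
  simp [hc]

/-- The non-vanishing loci of homogeneous polynomials form a basis of the Zariski topology. -/
theorem mem_nhds_pSpace_iff {n : ℕ} {p : PSpace n} {W : Set (PSpace n)} :
    W ∈ 𝓝 p ↔ ∃ (k : ℕ) (u : MvPolynomial (Fin n) ℂ), u.IsHomogeneous k ∧ eval p.rep u ≠ 0 ∧
      ∀ q : PSpace n, eval q.rep u ≠ 0 → q ∈ W := by
  have hb := TopologicalSpace.isTopologicalBasis_of_subbasis_of_inter
    (t := PSpace.zariskiTopology n) rfl (by
      rintro _ ⟨F, k, hF, rfl⟩ _ ⟨G, l, hG, rfl⟩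
      refine ⟨F * G, k + l, hF.mul hG, ?_⟩
      ext q
      simp)
  rw [hb.mem_nhds_iff]
  constructor
  · rintro ⟨U, hU, hp, hUW⟩
    rcases hU with rfl | ⟨u, k, hu, rfl⟩
    · exact ⟨0, 1, isHomogeneous_one _ _, by simp, fun q _ => hUW (by simp)⟩
    · exact ⟨k, u, hu, hp, fun q hq => hUW hq⟩
  · rintro ⟨k, u, hu, hp, h⟩
    exact ⟨_, Or.inr ⟨u, k, hu, rfl⟩, hp, h⟩

theorem isOpen_eval_ne_zero {n k : ℕ} {u : MvPolynomial (Fin n) ℂ} (hu : u.IsHomogeneous k) :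
    IsOpen {p : PSpace n | eval p.rep u ≠ 0} :=
  TopologicalSpace.isOpen_generateFrom_of_mem ⟨u, k, hu, rfl⟩

theorem mem_nhds_coe_iff {n : ℕ} {X : Set (PSpace n)} {p : X} {W : Set X} :
    W ∈ 𝓝 p ↔ ∃ (k : ℕ) (u : MvPolynomial (Fin n) ℂ), u.IsHomogeneous k ∧ eval p.1.rep u ≠ 0 ∧
      ∀ q : X, eval q.1.rep u ≠ 0 → q ∈ W := by
  rw [nhds_subtype, mem_comap]
  constructor
  · rintro ⟨V, hV, hVW⟩
    obtain ⟨k, u, hu, hp, h⟩ := mem_nhds_pSpace_iff.1 hV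
    exact ⟨k, u, hu, hp, fun q hq => hVW (h q.1 hq)⟩
  · rintro ⟨k, u, hu, hp, h⟩
    exact ⟨_, (isOpen_eval_ne_zero hu).mem_nhds hp, fun q hq => h q hq⟩

/-- A regular function on `X ⊆ ℙ` is near each point a quotient `g / h` such that the identity
`F h = g` holds on all of `X`: multiply numerator and denominator by a homogeneous polynomial that
vanishes outside the neighbourhood where the quotient represents `F`. -/
theorem regularAt_coe_iff {n : ℕ} {X : Set (PSpace n)} {p : X} {F : X → ℂ} :
    RegularAt F p ↔ ∃ (k : ℕ) (g h : MvPolynomial (Fin n) ℂ), g.IsHomogeneous k ∧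
      h.IsHomogeneous k ∧ eval p.1.rep h ≠ 0 ∧
      ∀ q : X, F q * eval q.1.rep h = eval q.1.rep g := by
  constructor
  · rintro ⟨F', ⟨k, g, h, hg, hh, H⟩, hF⟩
    have H' := continuous_subtype_val.continuousAt.eventually (f := ((↑) : X → PSpace n)) H
    obtain ⟨l, u, hu, hp, hW⟩ := mem_nhds_coe_iff.1 (H'.and hF)
    have hp' := hW p hp
    refine ⟨k + l, g * u, h * u, hg.mul hu, hh.mul hu, ?_, fun q => ?_⟩
    · simpa using ⟨hp'.1.1, hp⟩
    · by_cases hq : eval q.1.rep u = 0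
      · simp [hq]
      · obtain ⟨⟨h1, h2⟩, h3⟩ := hW q hq
        rw [show F q = F' q from h3, h2, map_mul, map_mul]
        field_simp
  · rintro ⟨k, g, h, hg, hh, hp, H⟩
    refine ⟨fun q => eval q.rep g / eval q.rep h, ⟨k, g, h, hg, hh, ?_⟩, ?_⟩
    · filter_upwards [(isOpen_eval_ne_zero hh).mem_nhds hp] with q hq
      exact ⟨hq, rfl⟩
    · filter_upwards [continuous_subtype_val.continuousAt.preimage_mem_nhds
        ((isOpen_eval_ne_zero hh).mem_nhds hp)] with q hq
      rw [← H q, mul_div_cancel_right₀ _ hq]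

/-! ### Laurent monomials and homogeneous Laurent functions -/

/-- The Laurent monomial `y ^ e = ∏ᵢ yᵢ ^ eᵢ`. It is meant for vectors without zero coordinates; at
a zero coordinate with a negative exponent it takes the value `0`. -/
noncomputable def mon {n : ℕ} (e : Fin n → ℤ) (y : Fin n → ℂ) : ℂ := ∏ i, y i ^ e i

/-- The monomial map `y ↦ y ^ M` whose components are the Laurent monomials with exponents the rows
of `M`. -/
noncomputable def monMap {n k : ℕ} (M : Matrix (Fin k) (Fin n) ℤ) (y : Fin n → ℂ) : Fin k → ℂ :=
  fun j => mon (M j) y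

section Laurent

variable {n k : ℕ}

theorem prod_zpow_exponent {ι : Type*} (s : Finset ι) {c : ℂ} (hc : c ≠ 0) (e : ι → ℤ) :
    ∏ i ∈ s, c ^ e i = c ^ ∑ i ∈ s, e i := by
  classical
  induction s using Finset.induction_on with
  | empty => simp
  | insert a s ha ih => rw [Finset.prod_insert ha, Finset.sum_insert ha, ih, zpow_add₀ hc]

theorem mon_ne_zero (e : Fin n → ℤ) {y : Fin n → ℂ} (hy : ∀ i, y i ≠ 0) : mon e y ≠ 0 :=
  Finset.prod_ne_zero_iff.2 fun i _ => zpow_ne_zero _ (hy i)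

theorem mon_add (e f : Fin n → ℤ) {y : Fin n → ℂ} (hy : ∀ i, y i ≠ 0) :
    mon (e + f) y = mon e y * mon f y := by
  simp only [mon, ← Finset.prod_mul_distrib, Pi.add_apply]
  exact Finset.prod_congr rfl fun i _ => zpow_add₀ (hy i) _ _

theorem mon_mul (e : Fin n → ℤ) (y z : Fin n → ℂ) : mon e (y * z) = mon e y * mon e z := by
  simp only [mon, ← Finset.prod_mul_distrib, Pi.mul_apply, mul_zpow]

theorem mon_smul (e : Fin n → ℤ) {c : ℂ} (hc : c ≠ 0) (y : Fin n → ℂ) :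
    mon e (c • y) = c ^ (∑ i, e i) * mon e y := by
  simp only [mon, Pi.smul_apply, smul_eq_mul, mul_zpow, Finset.prod_mul_distrib]
  rw [prod_zpow_exponent _ hc]

theorem mon_monMap (w : Fin k → ℤ) (M : Matrix (Fin k) (Fin n) ℤ) {y : Fin n → ℂ}
    (hy : ∀ i, y i ≠ 0) : mon w (monMap M y) = mon (Matrix.vecMul w M) y := by
  simp only [mon, monMap, Matrix.vecMul, dotProduct, ← Finset.prod_zpow]
  rw [Finset.prod_comm]
  refine Finset.prod_congr rfl fun i _ => ?_
  rw [← prod_zpow_exponent _ (hy i)]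
  simp only [← zpow_mul, mul_comm]

theorem monMap_ne_zero (M : Matrix (Fin k) (Fin n) ℤ) {y : Fin n → ℂ}
    (hy : ∀ i, y i ≠ 0) : ∀ j, monMap M y j ≠ 0 := fun _ => mon_ne_zero _ hy

theorem monMap_mul (M : Matrix (Fin k) (Fin n) ℤ) (y z : Fin n → ℂ) :
    monMap M (y * z) = monMap M y * monMap M z := funext fun _ => mon_mul _ _ _

theorem monMap_smul {M : Matrix (Fin k) (Fin n) ℤ} {s : ℤ} (hM : ∀ j, ∑ i, M j i = s) {c : ℂ}
    (hc : c ≠ 0) (y : Fin n → ℂ) : monMap M (c • y) = c ^ s • monMap M y := by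
  funext j
  simp [monMap, mon_smul _ hc, hM]

theorem monMap_monMap {l : ℕ} (N : Matrix (Fin l) (Fin k) ℤ) (M : Matrix (Fin k) (Fin n) ℤ)
    {y : Fin n → ℂ} (hy : ∀ i, y i ≠ 0) : monMap N (monMap M y) = monMap (N * M) y := by
  funext j
  exact mon_monMap _ _ hy

/-- `F` is given on the torus `∀ i, y i ≠ 0` by a Laurent polynomial homogeneous of degree `k`. This
is encoded by clearing denominators with a power of `∏ᵢ yᵢ`; values off the torus are ignored. -/
def IsLaurent (k : ℤ) (F : (Fin n → ℂ) → ℂ) : Prop :=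
  ∃ (N l : ℕ) (H : MvPolynomial (Fin n) ℂ), H.IsHomogeneous l ∧ (l : ℤ) = k + n * N ∧
    ∀ y : Fin n → ℂ, (∀ i, y i ≠ 0) → F y * (∏ i, y i) ^ N = eval y H

theorem isHomogeneous_prod_X (n N : ℕ) :
    ((∏ i : Fin n, X i : MvPolynomial (Fin n) ℂ) ^ N).IsHomogeneous (n * N) := by
  have h := IsHomogeneous.prod Finset.univ (fun i : Fin n => (X i : MvPolynomial (Fin n) ℂ))
    (fun _ => 1) fun i _ => isHomogeneous_X ℂ i
  simpa using h.pow N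

theorem IsLaurent.of_poly {l : ℕ} {H : MvPolynomial (Fin n) ℂ} (hH : H.IsHomogeneous l) :
    IsLaurent l (fun y => eval y H) :=
  ⟨0, l, H, hH, by simp, fun y _ => by simp⟩

/-- The power of `∏ᵢ yᵢ` used to clear denominators can be increased, so that finitely many Laurent
functions have a common one. -/
theorem IsLaurent.exists_ge {d : ℤ} {F : (Fin n → ℂ) → ℂ} (hF : IsLaurent d F) :
    ∃ N₀ : ℕ, ∀ N, N₀ ≤ N → ∃ (l : ℕ) (H : MvPolynomial (Fin n) ℂ), H.IsHomogeneous l ∧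
      (l : ℤ) = d + n * N ∧
      ∀ y : Fin n → ℂ, (∀ i, y i ≠ 0) → F y * (∏ i, y i) ^ N = eval y H := by
  obtain ⟨N₀, l, H, hH, hl, h⟩ := hF
  refine ⟨N₀, fun N hN => ?_⟩
  obtain ⟨r, rfl⟩ := Nat.exists_eq_add_of_le hN
  refine ⟨l + n * r, H * (∏ i, X i) ^ r, hH.mul (isHomogeneous_prod_X n r), ?_, fun y hy => ?_⟩
  · push_cast
    rw [hl]
    ring
  · rw [map_mul, ← h y hy, pow_add]
    simp [mul_assoc]

theorem IsLaurent.add {d : ℤ} {F G : (Fin n → ℂ) → ℂ} (hF : IsLaurent d F) (hG : IsLaurent d G) :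
    IsLaurent d (fun y => F y + G y) := by
  obtain ⟨N₁, h₁⟩ := hF.exists_ge
  obtain ⟨N₂, h₂⟩ := hG.exists_ge
  obtain ⟨l, H, hH, hl, h⟩ := h₁ (max N₁ N₂) (le_max_left _ _)
  obtain ⟨l', H', hH', hl', h'⟩ := h₂ (max N₁ N₂) (le_max_right _ _)
  obtain rfl : l = l' := by exact_mod_cast hl.trans hl'.symm
  exact ⟨_, l, H + H', hH.add hH', hl, fun y hy => by rw [add_mul, h y hy, h' y hy, map_add]⟩

theorem IsLaurent.zero [NeZero n] (d : ℤ) : IsLaurent d (fun _ : Fin n → ℂ => 0) := by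
  refine ⟨d.natAbs, (d + n * d.natAbs).toNat, 0, isHomogeneous_zero _ _ _, ?_, by simp⟩
  rw [Int.toNat_of_nonneg]
  have : (1 : ℤ) ≤ n := by exact_mod_cast NeZero.one_le
  nlinarith [neg_abs_le d, abs_nonneg d, Int.natCast_natAbs d]

theorem IsLaurent.sum [NeZero n] {ι : Type*} (s : Finset ι) {d : ℤ} {F : ι → (Fin n → ℂ) → ℂ}
    (hF : ∀ i ∈ s, IsLaurent d (F i)) : IsLaurent d (fun y => ∑ i ∈ s, F i y) := by
  classical
  induction s using Finset.induction_on with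
  | empty => simpa using IsLaurent.zero d
  | insert a s ha ih =>
    simp only [Finset.sum_insert ha]
    exact (hF a (by simp)).add (ih fun i hi => hF i (by simp [hi]))

theorem IsLaurent.monomial (e : Fin n → ℤ) (c : ℂ) :
    IsLaurent (∑ i, e i) (fun y => c * mon e y) := by
  set N := ∑ i, (e i).natAbs with hN
  have hpos : ∀ i, 0 ≤ e i + N := fun i => by
    have : (e i).natAbs ≤ N := Finset.single_le_sum (f := fun i => (e i).natAbs)
      (fun _ _ => Nat.zero_le _) (Finset.mem_univ i)
    omega
  refine ⟨N, ∑ i, (e i + N).toNat, C c * ∏ i, X i ^ (e i + N).toNat, ?_, ?_, fun y hy => ?_⟩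
  · simpa using (isHomogeneous_C (Fin n) c).mul (IsHomogeneous.prod Finset.univ _ _
      fun i _ => isHomogeneous_X_pow (R := ℂ) i (e i + N).toNat)
  · push_cast
    simp only [Int.toNat_of_nonneg (hpos _), Finset.sum_add_distrib]
    simp
  · simp only [map_mul, eval_C, map_prod, map_pow, eval_X, mon, mul_assoc, ← Finset.prod_pow,
      ← Finset.prod_mul_distrib]
    congr 1
    refine Finset.prod_congr rfl fun i _ => ?_
    rw [← zpow_natCast, ← zpow_natCast, Int.toNat_of_nonneg (hpos i), zpow_add₀ (hy i)]

/-- A homogeneous Laurent function is a finite linear combination of Laurent monomials. -/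
theorem IsLaurent.exists_eq_sum {d : ℤ} {F : (Fin n → ℂ) → ℂ} (hF : IsLaurent d F) :
    ∃ (S : Finset (Fin n → ℤ)) (c : (Fin n → ℤ) → ℂ), (∀ e ∈ S, ∑ i, e i = d) ∧
      ∀ y : Fin n → ℂ, (∀ i, y i ≠ 0) → F y = ∑ e ∈ S, c e * mon e y := by
  classical
  obtain ⟨N, l, H, hH, hl, h⟩ := hF
  obtain ⟨φ, hφ⟩ : ∃ φ : (Fin n →₀ ℕ) ↪ (Fin n → ℤ), ∀ m i, φ m i = (m i : ℤ) - N :=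
    ⟨⟨fun m i => (m i : ℤ) - N, fun m m' (hm : (fun i => (m i : ℤ) - N) = _) => Finsupp.ext
      fun i => by simpa using congrFun hm i⟩, fun _ _ => rfl⟩
  refine ⟨H.support.map φ,
    fun e => coeff (Finsupp.equivFunOnFinite.symm fun i => (e i + N).toNat) H, ?_, fun y hy => ?_⟩
  · intro e he
    rw [Finset.mem_map] at he
    obtain ⟨m, hm, rfl⟩ := he
    have h := hH (mem_support_iff.1 hm)
    rw [Finsupp.weight_apply, Finsupp.sum_fintype _ _ (by simp)] at h
    simp only [Pi.one_apply, smul_eq_mul, mul_one] at h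
    have h' : ∑ i, (m i : ℤ) = l := by exact_mod_cast h
    simp only [hφ, Finset.sum_sub_distrib, h', hl]
    simp
  · rw [Finset.sum_map]
    have hm : ∀ m, (Finsupp.equivFunOnFinite.symm fun i => (φ m i + N).toNat) = m := fun m => by
      ext i
      simp [hφ]
    simp only [hm]
    have hP : (∏ i, y i) ^ N ≠ 0 := pow_ne_zero _ (Finset.prod_ne_zero_iff.2 fun i _ => hy i)
    rw [← mul_left_inj' hP, h y hy, eval_eq', Finset.sum_mul]
    refine Finset.sum_congr rfl fun m _ => ?_
    rw [mul_assoc]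
    congr 1
    simp only [hφ, mon, ← Finset.prod_pow, ← Finset.prod_mul_distrib]
    refine Finset.prod_congr rfl fun i _ => ?_
    rw [zpow_sub₀ (hy i), zpow_natCast, zpow_natCast,
      div_mul_cancel₀ _ (pow_ne_zero _ (hy i))]

theorem IsLaurent.of_sum [NeZero n] {d : ℤ} {ι : Type*} (s : Finset ι) (c : ι → ℂ)
    (e : ι → Fin n → ℤ) (he : ∀ i ∈ s, ∑ j, e i j = d) :
    IsLaurent d (fun y => ∑ i ∈ s, c i * mon (e i) y) :=
  IsLaurent.sum s fun i hi => he i hi ▸ IsLaurent.monomial (e i) (c i)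

theorem IsLaurent.congr {d : ℤ} {F G : (Fin n → ℂ) → ℂ} (hF : IsLaurent d F)
    (h : ∀ y, (∀ i, y i ≠ 0) → F y = G y) : IsLaurent d G := by
  obtain ⟨N, l, H, hH, hl, h'⟩ := hF
  exact ⟨N, l, H, hH, hl, fun y hy => by rw [← h y hy, h' y hy]⟩

/-- Pull-back along a monomial map multiplies the degree by the common row sum. -/
theorem IsLaurent.comp_monMap [NeZero n] {M : Matrix (Fin k) (Fin n) ℤ} {s : ℤ}
    (hM : ∀ j, ∑ i, M j i = s) {d : ℤ} {F : (Fin k → ℂ) → ℂ} (hF : IsLaurent d F) :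
    IsLaurent (d * s) (fun y => F (monMap M y)) := by
  obtain ⟨S, c, hc, h⟩ := hF.exists_eq_sum
  refine (IsLaurent.of_sum S c (fun e => Matrix.vecMul e M) fun e he => ?_).congr
    fun y hy => ?_
  · simp only [Matrix.vecMul, dotProduct]
    rw [Finset.sum_comm]
    simp only [← Finset.mul_sum, hM, ← Finset.sum_mul, hc e he]
  · rw [h _ (monMap_ne_zero M hy)]
    simp only [mon_monMap _ _ hy]

theorem IsLaurent.smul_eq {d : ℤ} {F : (Fin n → ℂ) → ℂ} (hF : IsLaurent d F) {c : ℂ} (hc : c ≠ 0)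
    {y : Fin n → ℂ} (hy : ∀ i, y i ≠ 0) : F (c • y) = c ^ d * F y := by
  obtain ⟨S, a, ha, h⟩ := hF.exists_eq_sum
  rw [h y hy, h (c • y) fun i => by simp [hc, hy i], Finset.mul_sum]
  refine Finset.sum_congr rfl fun e he => ?_
  rw [mon_smul _ hc, ha e he]
  ring

end Laurent

theorem prod_ne_zero_iff_forall {n : ℕ} {y : Fin n → ℂ} : ∏ i, y i ≠ 0 ↔ ∀ i, y i ≠ 0 := by
  simp [Finset.prod_ne_zero_iff]

/-- Near points with nonzero coordinates, open sets are described by Laurent functions. -/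
theorem mem_nhds_iff_isLaurent {n : ℕ} {X : Set (PSpace n)} {p : X} (hp : ∀ i, p.1.rep i ≠ 0)
    {W : Set X} :
    W ∈ 𝓝 p ↔ ∃ (d : ℤ) (h : (Fin n → ℂ) → ℂ), IsLaurent d h ∧ h p.1.rep ≠ 0 ∧
      ∀ q : X, (∀ i, q.1.rep i ≠ 0) → h q.1.rep ≠ 0 → q ∈ W := by
  rw [mem_nhds_coe_iff]
  constructor
  · rintro ⟨k, u, hu, hup, H⟩
    exact ⟨k, _, IsLaurent.of_poly hu, hup, fun q _ hq => H q hq⟩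
  · rintro ⟨d, h, ⟨N, l, H, hH, -, hy⟩, hhp, hW⟩
    refine ⟨l + n * 1, H * (∏ i, MvPolynomial.X i) ^ 1,
      hH.mul (isHomogeneous_prod_X n 1), ?_, fun q hq => ?_⟩
    · have := prod_ne_zero_iff_forall.2 hp
      simp only [map_mul, ← hy _ hp, map_pow, map_prod, eval_X]
      exact mul_ne_zero (mul_ne_zero hhp (pow_ne_zero _ this)) (pow_ne_zero _ this)
    · simp only [map_mul, pow_one, map_prod, eval_X] at hq
      have hq' := prod_ne_zero_iff_forall.1 (right_ne_zero_of_mul hq)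
      refine hW q hq' fun h0 => left_ne_zero_of_mul hq ?_
      rw [← hy _ hq', h0, zero_mul]

/-- Near points with nonzero coordinates, regular functions are quotients of Laurent functions of
the same degree, and the identity `F h = g` may be assumed at all points with nonzero
coordinates. -/
theorem regularAt_iff_isLaurent {n : ℕ} {X : Set (PSpace n)} {p : X} (hp : ∀ i, p.1.rep i ≠ 0)
    {F : X → ℂ} :
    RegularAt F p ↔ ∃ (d : ℤ) (g h : (Fin n → ℂ) → ℂ), IsLaurent d g ∧ IsLaurent d h ∧
      h p.1.rep ≠ 0 ∧ ∀ q : X, (∀ i, q.1.rep i ≠ 0) → F q * h q.1.rep = g q.1.rep := by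
  rw [regularAt_coe_iff]
  constructor
  · rintro ⟨k, g, h, hg, hh, hhp, H⟩
    exact ⟨k, _, _, IsLaurent.of_poly hg, IsLaurent.of_poly hh, hhp, fun q _ => H q⟩
  · rintro ⟨d, g, h, hg, hh, hhp, H⟩
    obtain ⟨N₁, h₁⟩ := hg.exists_ge
    obtain ⟨N₂, h₂⟩ := hh.exists_ge
    obtain ⟨l, G, hG, hl, hyG⟩ := h₁ (max N₁ N₂) (le_max_left _ _)
    obtain ⟨l', H', hH', hl', hyH⟩ := h₂ (max N₁ N₂) (le_max_right _ _)
    obtain rfl : l = l' := by exact_mod_cast hl.trans hl'.symm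
    refine ⟨l + n * 1, G * (∏ i, MvPolynomial.X i) ^ 1,
      H' * (∏ i, MvPolynomial.X i) ^ 1, hG.mul (isHomogeneous_prod_X n 1),
      hH'.mul (isHomogeneous_prod_X n 1), ?_, fun q => ?_⟩
    · have := prod_ne_zero_iff_forall.2 hp
      simp only [map_mul, ← hyH _ hp, map_pow, map_prod, eval_X]
      exact mul_ne_zero (mul_ne_zero hhp (pow_ne_zero _ this)) (pow_ne_zero _ this)
    · simp only [map_mul, pow_one, map_prod, eval_X]
      by_cases hq : ∏ i, q.1.rep i = 0
      · simp [hq]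
      · have hq' := prod_ne_zero_iff_forall.1 hq
        rw [← hyH _ hq', ← hyG _ hq', ← H q hq']
        ring

/-! ### Descent of Laurent functions along a monomial map -/

/-- The homomorphism `ℚ/ℤ → ℂˣ`, `q ↦ exp (2πiq)`. -/
noncomputable def ratCircleHom : AddCircle (1 : ℚ) →+ Additive ℂˣ :=
  QuotientAddGroup.lift _
    { toFun := fun q => Additive.ofMul
        (Units.mk0 (Complex.exp (2 * Real.pi * Complex.I * q)) (Complex.exp_ne_zero _))
      map_zero' := by
        apply Additive.toMul.injective
        ext
        simp
      map_add' := fun a b => by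
        apply Additive.toMul.injective
        ext
        simp [mul_add, Complex.exp_add] }
    (by
      intro q hq
      obtain ⟨z, rfl⟩ := AddSubgroup.mem_zmultiples_iff.1 hq
      apply Additive.toMul.injective
      ext
      simpa [mul_comm] using Complex.exp_int_mul_two_pi_mul_I z)

theorem ratCircleHom_injective : Function.Injective ratCircleHom := by
  rw [injective_iff_map_eq_zero]
  intro a ha
  induction a using QuotientAddGroup.induction_on with
  | H q =>
    have h : Complex.exp (2 * Real.pi * Complex.I * q) = 1 :=
      congrArg (fun u : Additive ℂˣ => ((Additive.toMul u : ℂˣ) : ℂ)) ha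
    obtain ⟨z, hz⟩ := Complex.exp_eq_one_iff.1 h
    have h2 : (q : ℂ) = (z : ℂ) := by
      rw [mul_comm (z : ℂ)] at hz
      exact mul_left_cancel₀ Complex.two_pi_I_ne_zero hz
    have h3 : q = z := by exact_mod_cast h2
    refine (QuotientAddGroup.eq_zero_iff _).2 (AddSubgroup.mem_zmultiples_iff.2 ⟨z, ?_⟩)
    simp [h3]

section Descent

variable {n k : ℕ}

/-- The lattice of exponents of the Laurent monomials pulled back along `y ↦ y ^ M`. -/
def rowLattice (M : Matrix (Fin k) (Fin n) ℤ) : AddSubgroup (Fin n → ℤ) :=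
  (Matrix.vecMulLinear M).range.toAddSubgroup

theorem mem_rowLattice {M : Matrix (Fin k) (Fin n) ℤ} {e : Fin n → ℤ} :
    e ∈ rowLattice M ↔ ∃ w, Matrix.vecMul w M = e := by
  simp [rowLattice]

/-- An exponent outside the row lattice of `M` gives a nontrivial character of the kernel of
`y ↦ y ^ M`: compose a character of `ℤⁿ / rowLattice M` into `ℚ/ℤ` with `ℚ/ℤ → ℂˣ`. -/
theorem exists_mon_ne_one_of_notMem_rowLattice {M : Matrix (Fin k) (Fin n) ℤ} {e : Fin n → ℤ}
    (he : e ∉ rowLattice M) :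
    ∃ c : Fin n → ℂ, (∀ i, c i ≠ 0) ∧ monMap M c = 1 ∧ mon e c ≠ 1 := by
  have hne : (QuotientAddGroup.mk e : (Fin n → ℤ) ⧸ rowLattice M) ≠ 0 := fun h =>
    he ((QuotientAddGroup.eq_zero_iff _).1 h)
  obtain ⟨χ, hχ⟩ := CharacterModule.exists_character_apply_ne_zero_of_ne_zero hne
  let ψ : (Fin n → ℤ) →+ Additive ℂˣ :=
    (ratCircleHom.comp (χ : _ →+ AddCircle (1 : ℚ))).comp (QuotientAddGroup.mk' (rowLattice M))
  have hmon : ∀ f : Fin n → ℤ,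
      mon f (fun i => ((Additive.toMul (ψ (Pi.single i 1)) : ℂˣ) : ℂ)) =
        ((Additive.toMul (ψ f) : ℂˣ) : ℂ) := by
    intro f
    have hf : f = ∑ i, f i • (Pi.single i (1 : ℤ) : Fin n → ℤ) := by
      ext j
      simp [Finset.sum_apply, Pi.single_apply]
    conv_rhs => rw [hf, map_sum, toMul_sum]
    simp only [mon, Units.coe_prod, map_zsmul, toMul_zsmul, Units.val_zpow_eq_zpow_val]
  refine ⟨fun i => ((Additive.toMul (ψ (Pi.single i 1)) : ℂˣ) : ℂ),
    fun i => Units.ne_zero _, funext fun j => ?_, fun h => hχ ?_⟩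
  · rw [monMap, hmon]
    have : (QuotientAddGroup.mk (M j) : (Fin n → ℤ) ⧸ rowLattice M) = 0 :=
      (QuotientAddGroup.eq_zero_iff _).2 (mem_rowLattice.2 ⟨Pi.single j 1, by simp; rfl⟩)
    have h2 : ψ (M j) = 0 := by
      simp only [ψ, AddMonoidHom.comp_apply, QuotientAddGroup.mk'_apply, this, map_zero]
    rw [h2]
    rfl
  · rw [hmon] at h
    have h2 : ψ e = 0 := Additive.toMul.injective (Units.ext h)
    exact ratCircleHom_injective (h2.trans (map_zero _).symm)

/-- Laurent monomials whose exponents lie in different classes modulo the row lattice of `M` are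
linearly independent functions on the kernel of `y ↦ y ^ M`: they restrict to distinct
characters. -/
theorem eq_zero_of_sum_mon_out_eq_zero {M : Matrix (Fin k) (Fin n) ℤ}
    (I : Finset ((Fin n → ℤ) ⧸ rowLattice M)) (a : (Fin n → ℤ) ⧸ rowLattice M → ℂ)
    (h : ∀ c : Fin n → ℂ, (∀ i, c i ≠ 0) → monMap M c = 1 → ∑ q ∈ I, a q * mon q.out c = 0) :
    ∀ q ∈ I, a q = 0 := by
  let K : Subgroup (Fin n → ℂˣ) :=
    { carrier := {c | monMap M (fun i => (c i : ℂ)) = 1}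
      one_mem' := by
        funext j
        simp [monMap, mon]
      mul_mem' := by
        intro a b (ha : _ = _) (hb : _ = _)
        have := monMap_mul M (fun i => (a i : ℂ)) (fun i => (b i : ℂ))
        rw [ha, hb, one_mul] at this
        exact this
      inv_mem' := by
        intro a (ha : _ = _)
        funext j
        have := congrFun ha j
        simp only [monMap, mon] at this ⊢
        simp [this] }
  let χ : (Fin n → ℤ) ⧸ rowLattice M → (K →* ℂ) := fun q =>
    { toFun := fun c => mon q.out (fun i => (c.1 i : ℂ))
      map_one' := by simp [mon]
      map_mul' := fun a b => mon_mul _ _ _ }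
  have hχ : Function.Injective χ := by
    intro q r hqr
    by_contra hne
    have hnot : q.out - r.out ∉ rowLattice M := fun hmem => hne (by
      rw [← q.out_eq', ← r.out_eq']
      exact (QuotientAddGroup.eq_iff_sub_mem).2 hmem)
    obtain ⟨c, hc, hcM, hce⟩ := exists_mon_ne_one_of_notMem_rowLattice hnot
    have h1 := congrArg (fun φ : K →* ℂ => φ ⟨fun i => Units.mk0 (c i) (hc i), hcM⟩) hqr
    have h1 : mon q.out c = mon r.out c := h1
    have h2 := mon_add (q.out - r.out) r.out hc
    rw [sub_add_cancel, h1] at h2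
    exact hce (mul_right_cancel₀ (mon_ne_zero r.out hc) (by rw [one_mul]; exact h2.symm))
  have hli := (linearIndependent_monoidHom K ℂ).comp χ hχ
  refine linearIndependent_iff'.1 hli I a (funext fun c => ?_)
  have := h (fun i => (c.1 i : ℂ)) (fun i => Units.ne_zero _) c.2
  simpa [χ, Finset.sum_apply] using this

/-- Two Laurent functions of the same degree are sums, over finitely many classes of exponents
modulo the row lattice of `M`, of a monomial times a Laurent function of `y ^ M`; for each class the
two Laurent functions of `y ^ M` have the same degree. -/
theorem IsLaurent.exists_descent [NeZero k] {M : Matrix (Fin k) (Fin n) ℤ} {s : ℤ} (hs : s ≠ 0)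
    (hM : ∀ j, ∑ i, M j i = s) {d : ℤ} {g h : (Fin n → ℂ) → ℂ} (hg : IsLaurent d g)
    (hh : IsLaurent d h) :
    ∃ (I : Finset ((Fin n → ℤ) ⧸ rowLattice M)) (D : (Fin n → ℤ) ⧸ rowLattice M → ℤ)
      (P Q : (Fin n → ℤ) ⧸ rowLattice M → (Fin k → ℂ) → ℂ),
      (∀ q, IsLaurent (D q) (P q)) ∧ (∀ q, IsLaurent (D q) (Q q)) ∧
      ∀ y : Fin n → ℂ, (∀ i, y i ≠ 0) →
        g y = ∑ q ∈ I, mon q.out y * P q (monMap M y) ∧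
        h y = ∑ q ∈ I, mon q.out y * Q q (monMap M y) := by
  classical
  obtain ⟨S, a, hS, ha⟩ := hg.exists_eq_sum
  obtain ⟨T, b, hT, hb⟩ := hh.exists_eq_sum
  let π : (Fin n → ℤ) → (Fin n → ℤ) ⧸ rowLattice M := QuotientAddGroup.mk
  have hw : ∀ f, ∃ w, Matrix.vecMul w M = f - (π f).out := fun f =>
    mem_rowLattice.1 ((QuotientAddGroup.eq_iff_sub_mem).1 (π f).out_eq'.symm)
  choose w hw using hw
  have hsum : ∀ f, (∑ j, w f j) * s = ∑ i, f i - ∑ i, (π f).out i := fun f => by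
    rw [← Finset.sum_sub_distrib]
    simp only [← Pi.sub_apply, ← hw, Matrix.vecMul, dotProduct]
    rw [Finset.sum_comm, Finset.sum_mul]
    simp only [← Finset.mul_sum, hM]
  have key : ∀ (S : Finset (Fin n → ℤ)) (a : (Fin n → ℤ) → ℂ), (∀ e ∈ S, ∑ i, e i = d) → ∀ q,
      IsLaurent ((d - ∑ i, q.out i) / s)
        (fun x : Fin k → ℂ => ∑ f ∈ S with π f = q, a f * mon (w f) x) := by
    intro S a hS q
    refine IsLaurent.of_sum _ _ _ fun f hf => ?_
    obtain ⟨hfS, rfl⟩ := Finset.mem_filter.1 hf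
    rw [← hS f hfS, ← hsum, Int.mul_ediv_cancel _ hs]
  have key2 : ∀ (S : Finset (Fin n → ℤ)) (a : (Fin n → ℤ) → ℂ) (I : Finset _),
      (∀ e ∈ S, π e ∈ I) → ∀ y : Fin n → ℂ, (∀ i, y i ≠ 0) →
      ∑ e ∈ S, a e * mon e y = ∑ q ∈ I, mon q.out y *
        ∑ f ∈ S with π f = q, a f * mon (w f) (monMap M y) := by
    intro S a I hI y hy
    rw [← Finset.sum_fiberwise_of_maps_to hI]
    refine Finset.sum_congr rfl fun q _ => ?_
    rw [Finset.mul_sum]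
    refine Finset.sum_congr rfl fun f hf => ?_
    obtain ⟨-, rfl⟩ := Finset.mem_filter.1 hf
    have hf' := mon_add (π f).out (f - (π f).out) hy
    rw [add_sub_cancel] at hf'
    rw [mon_monMap _ _ hy, hw, hf']
    ring
  refine ⟨(S ∪ T).image π, _, _, _, key S a hS, key T b hT, fun y hy => ⟨?_, ?_⟩⟩
  · rw [ha y hy]
    exact key2 S a _ (fun e he => Finset.mem_image_of_mem _ (Finset.mem_union_left _ he)) y hy
  · rw [hb y hy]
    exact key2 T b _ (fun e he => Finset.mem_image_of_mem _ (Finset.mem_union_right _ he)) y hy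

end Descent

/-! ### Quotients of spaces with functions -/

/-- On an open subset, regularity for the induced structure is regularity in the ambient space. -/
theorem regularAt_restrict_iff {Z : Type} [TopologicalSpace Z] [FunctionSheaf Z] {S : Set Z}
    (hS : IsOpen S) {f : Z → ℂ} {x : S} : RegularAt (fun y : S => f y) x ↔ RegularAt f (x : Z) := by
  constructor
  · rintro ⟨g, hg, hfg⟩
    refine FunctionSheaf.congr ?_ hg
    have h : ∀ᶠ y in map ((↑) : S → Z) (𝓝 x), g y = f y := by
      exact eventually_map.2 hfg.symm
    rwa [map_nhds_subtype_val, hS.nhdsWithin_eq x.2] at h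
  · exact fun h => ⟨f, h, EventuallyEq.rfl⟩

/-- If `φ` maps a dense open `G`-invariant set `U ⊆ X` onto a dense open set `V ⊆ Y`, is continuous
and open on `U`, has the `G`-orbits as fibres there and detects regularity, then `f` with `f = φ` on
`U` is birational to the quotient map by `G`. -/
theorem birationalToQuotient_of_isOpen {X Y : Type} [TopologicalSpace X] [FunctionSheaf X]
    [TopologicalSpace Y] [FunctionSheaf Y] (f : X →. Y) (G : Subgroup (Aut X)) (φ : X → Y)
    (U : Set X) (V : Set Y) (hU : IsOpen U) (hUd : Dense U) (hV : IsOpen V) (hVd : Dense V)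
    (hf : ∀ x ∈ U, φ x ∈ f x) (hmaps : ∀ x ∈ U, φ x ∈ V) (hsurj : ∀ y ∈ V, ∃ x ∈ U, φ x = y)
    (hcont : ∀ x ∈ U, ContinuousAt φ x) (hopen : ∀ W ⊆ U, IsOpen W → IsOpen (φ '' W))
    (hG : ∀ g ∈ G, ∀ x ∈ U, (g : Equiv.Perm X) x ∈ U)
    (hfib : ∀ x ∈ U, ∀ x' ∈ U, φ x = φ x' ↔ ∃ g ∈ G, (g : Equiv.Perm X) x = x')
    (hreg : ∀ (F : Y → ℂ), ∀ x ∈ U, RegularAt F (φ x) ↔ RegularAt (fun x' => F (φ x')) x) :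
    BirationalToQuotient f G := by
  classical
  have horb : ∀ x x', orbitMap G X x = orbitMap G X x' → ∃ g ∈ G, (g : Equiv.Perm X) x = x' := by
    intro x x' h
    obtain ⟨g, hg⟩ := MulAction.orbitRel_apply.1 (Quotient.exact h.symm)
    exact ⟨g.1, g.2, hg⟩
  have horb' : ∀ x, ∀ g ∈ G, orbitMap G X x = orbitMap G X ((g : Equiv.Perm X) x) := by
    intro x g hg
    exact (Quotient.sound (MulAction.orbitRel_apply.2 ⟨(⟨g, hg⟩ : G), rfl⟩)).symm
  -- saturated open sets of the form `U ∩ φ⁻¹ W` have open image in the quotient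
  have hpre : ∀ W : Set Y, ∀ x, orbitMap G X x ∈ orbitMap G X '' (U ∩ φ ⁻¹' W) →
      x ∈ U ∩ φ ⁻¹' W := by
    rintro W x ⟨x', ⟨hx'U, hx'W⟩, h⟩
    obtain ⟨g, hg, rfl⟩ := horb _ _ h
    have hgU := hG g hg x' hx'U
    refine ⟨hgU, ?_⟩
    have := (hfib x' hx'U _ hgU).2 ⟨g, hg, rfl⟩
    rw [Set.mem_preimage, ← this]
    exact hx'W
  have hopenQ : ∀ W : Set Y, IsOpen W → IsOpen (orbitMap G X '' (U ∩ φ ⁻¹' W)) := by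
    intro W hW
    refine isOpen_coinduced.2 ?_
    have : orbitMap G X ⁻¹' (orbitMap G X '' (U ∩ φ ⁻¹' W)) = U ∩ φ ⁻¹' W :=
      Set.Subset.antisymm (fun x hx => hpre W x hx) (Set.subset_preimage_image _ _)
    rw [this, isOpen_iff_mem_nhds]
    rintro x ⟨hxU, hxW⟩
    exact inter_mem (hU.mem_nhds hxU) ((hcont x hxU).preimage_mem_nhds (hW.mem_nhds hxW))
  set U₂ : Set (OrbitSpace G X) := orbitMap G X '' U with hU₂
  have hU₂open : IsOpen U₂ := by simpa using hopenQ Set.univ isOpen_univ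
  have hU₂dense : Dense U₂ := by
    refine DenseRange.dense_image ?_ (continuous_orbitMap G X) hUd
    exact (Quotient.mk_surjective).denseRange
  have hsurj' : ∀ y : V, ∃ x ∈ U, φ x = y := fun y => hsurj y y.2
  choose σ hσU hσ using hsurj'
  have hψ : Function.Bijective
      (fun y : V => (⟨orbitMap G X (σ y), σ y, hσU y, rfl⟩ : U₂)) := by
    constructor
    · intro y y' h
      obtain ⟨g, hg, h⟩ := horb _ _ (congrArg Subtype.val h)
      have := (hfib _ (hσU y) _ (hσU y')).2 ⟨g, hg, h⟩
      rw [hσ y, hσ y'] at this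
      exact Subtype.ext this
    · rintro ⟨_, x, hx, rfl⟩
      refine ⟨⟨φ x, hmaps x hx⟩, Subtype.ext ?_⟩
      obtain ⟨g, hg, h⟩ := (hfib _ (hσU ⟨φ x, hmaps x hx⟩) _ hx).1 (hσ ⟨φ x, hmaps x hx⟩)
      change orbitMap G X (σ ⟨φ x, hmaps x hx⟩) = orbitMap G X x
      rw [horb' _ g hg, h]
  set ψ : V ≃ U₂ := Equiv.ofBijective _ hψ with hψdef
  have hψφ : ∀ x (hx : x ∈ U), ψ ⟨φ x, hmaps x hx⟩ = ⟨orbitMap G X x, x, hx, rfl⟩ := by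
    intro x hx
    refine Subtype.ext ?_
    obtain ⟨g, hg, h⟩ := (hfib _ (hσU ⟨φ x, hmaps x hx⟩) _ hx).1 (hσ ⟨φ x, hmaps x hx⟩)
    change orbitMap G X (σ ⟨φ x, hmaps x hx⟩) = orbitMap G X x
    rw [horb' _ g hg, h]
  have hψ₁ : ∀ y : V, ∃ x, ∃ hx : x ∈ U, y = ⟨φ x, hmaps x hx⟩ := fun y =>
    ⟨σ y, hσU y, Subtype.ext (hσ y).symm⟩
  refine ⟨U, V, U₂, ψ, hU, hUd, hV, hVd, hU₂open, hU₂dense, ⟨?_, ?_, ?_⟩, ?_⟩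
  · -- `ψ` is continuous because `φ` is open
    rw [continuous_def]
    rintro _ ⟨W, hW, rfl⟩
    refine ⟨φ '' (U ∩ orbitMap G X ⁻¹' W), hopen _ Set.inter_subset_left
      (hU.inter (hW.preimage (continuous_orbitMap G X))), ?_⟩
    ext y
    obtain ⟨x, hx, rfl⟩ := hψ₁ y
    simp only [Set.mem_preimage, hψφ x hx]
    constructor
    · rintro ⟨x', ⟨hx'U, hx'W⟩, h⟩
      obtain ⟨g, hg, rfl⟩ := (hfib x' hx'U x hx).1 h
      rw [← horb' _ g hg]
      exact hx'W
    · exact fun h => ⟨x, ⟨hx, h⟩, rfl⟩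
  · -- the inverse of `ψ` is continuous because `φ` is continuous
    rw [continuous_def]
    rintro _ ⟨W, hW, rfl⟩
    refine ⟨_, hopenQ W hW, ?_⟩
    ext z
    obtain ⟨y, rfl⟩ := ψ.surjective z
    obtain ⟨x, hx, rfl⟩ := hψ₁ y
    simp only [Set.mem_preimage, Equiv.symm_apply_apply]
    rw [hψφ x hx]
    exact ⟨fun h => (hpre W x h).2, fun h => ⟨x, ⟨hx, h⟩, rfl⟩⟩
  · intro F y
    obtain ⟨x, hx, rfl⟩ := hψ₁ y
    set Fq : OrbitSpace G X → ℂ := fun q => if h : q ∈ U₂ then F ⟨q, h⟩ else 0 with hFq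
    set Fy : Y → ℂ := fun y => if h : y ∈ V then F (ψ ⟨y, h⟩) else 0 with hFy
    have h1 : F = fun q : U₂ => Fq q := by
      funext q
      simp [hFq]
    have h2 : (fun y : V => F (ψ y)) = fun y : V => Fy y := by
      funext y
      simp [hFy]
    have h3 : ∀ x ∈ U, Fy (φ x) = Fq (orbitMap G X x) := by
      intro x hx
      have hm : orbitMap G X x ∈ U₂ := ⟨x, hx, rfl⟩
      simp only [hFy, hFq, dif_pos (hmaps x hx), dif_pos hm, hψφ x hx]
    have h4 : ∀ x ∈ U, RegularAt Fy (φ x) ↔ RegularAt (fun x' => Fq (orbitMap G X x')) x := by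
      intro x hx
      rw [hreg Fy x hx]
      have : (fun x' => Fy (φ x')) =ᶠ[𝓝 x] fun x' => Fq (orbitMap G X x') := by
        filter_upwards [hU.mem_nhds hx] with x' hx'
        exact h3 x' hx'
      exact ⟨FunctionSheaf.congr this, FunctionSheaf.congr this.symm⟩
    rw [h2, regularAt_restrict_iff hV]
    conv_lhs => rw [h1]
    rw [regularAt_restrict_iff hU₂open, hψφ x hx]
    constructor
    · intro h
      exact (h4 x hx).2 (Eventually.self_of_nhds (show ∀ᶠ q' in 𝓝 (orbitMap G X x), _ from h) x rfl)
    · intro h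
      have hW : IsOpen {y | RegularAt Fy y} := by
        rw [isOpen_iff_mem_nhds]
        exact fun y hy => FunctionSheaf.eventually hy
      change ∀ᶠ q' in 𝓝 (orbitMap G X x), _
      filter_upwards [(hopenQ _ hW).mem_nhds ⟨x, ⟨hx, h⟩, rfl⟩] with q' hq' x' hx'
      subst hx'
      obtain ⟨hU', hW'⟩ := hpre _ x' hq'
      exact (h4 x' hU').1 hW'
  · intro x hx
    refine ⟨⟨φ x, hmaps x hx⟩, hf x hx, ?_⟩
    rw [hψφ x hx]
    exact Part.mem_some _

/-! ### Monomial maps as quotient maps -/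

theorem isOpen_torus {n : ℕ} {X : Set (PSpace n)} : IsOpen {p : X | ∀ i, p.1.rep i ≠ 0} := by
  rw [isOpen_iff_mem_nhds]
  intro p hp
  refine mem_nhds_coe_iff.2 ⟨_, _, isHomogeneous_prod_X n 1, ?_, fun q hq => ?_⟩
  · simpa [Finset.prod_ne_zero_iff] using hp
  · simpa [Finset.prod_ne_zero_iff] using hq

section TorusPoints

variable {n k : ℕ} [NeZero n] [NeZero k]

/-- The point of projective space with the given nonzero homogeneous coordinates. -/
noncomputable def torusPt (v : Fin n → ℂ) (hv : ∀ i, v i ≠ 0) : PSpace n :=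
  Projectivization.mk ℂ v fun h => hv 0 (congrFun h 0)

theorem torusPt_rep {p : PSpace n} (hp : ∀ i, p.rep i ≠ 0) : torusPt p.rep hp = p := p.mk_rep

theorem exists_torusPt_rep (v : Fin n → ℂ) (hv : ∀ i, v i ≠ 0) :
    ∃ c : ℂ, c ≠ 0 ∧ (torusPt v hv).rep = c • v := exists_rep_eq_smul _

theorem torusPt_rep_ne_zero (v : Fin n → ℂ) (hv : ∀ i, v i ≠ 0) :
    ∀ i, (torusPt v hv).rep i ≠ 0 := by
  obtain ⟨c, hc, h⟩ := exists_torusPt_rep v hv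
  intro i
  rw [h]
  exact mul_ne_zero hc (hv i)

theorem torusPt_eq_iff {v w : Fin n → ℂ} {hv : ∀ i, v i ≠ 0} {hw : ∀ i, w i ≠ 0} :
    torusPt v hv = torusPt w hw ↔ ∃ c : ℂ, c ≠ 0 ∧ w = c • v := by
  rw [torusPt, torusPt, eq_comm, Projectivization.mk_eq_mk_iff']
  refine ⟨fun ⟨a, ha⟩ => ⟨a, ?_, ha.symm⟩, fun ⟨a, _, ha⟩ => ⟨a, ha.symm⟩⟩
  rintro rfl
  exact hw 0 (by rw [← ha]; simp)

theorem torusPt_monMap_eq {M : Matrix (Fin k) (Fin n) ℤ} {s : ℤ} (hM : ∀ j, ∑ i, M j i = s)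
    {v w : Fin n → ℂ} {hv : ∀ i, v i ≠ 0} {hw : ∀ i, w i ≠ 0} (h : torusPt v hv = torusPt w hw) :
    torusPt (monMap M v) (monMap_ne_zero M hv) = torusPt (monMap M w) (monMap_ne_zero M hw) := by
  obtain ⟨c, hc, rfl⟩ := torusPt_eq_iff.1 h
  exact torusPt_eq_iff.2 ⟨c ^ s, zpow_ne_zero _ hc, monMap_smul hM hc v⟩

theorem IsLaurent.rep_torusPt_eq_zero_iff {d : ℤ} {F : (Fin n → ℂ) → ℂ} (hF : IsLaurent d F)
    {v : Fin n → ℂ} (hv : ∀ i, v i ≠ 0) : F (torusPt v hv).rep = 0 ↔ F v = 0 := by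
  obtain ⟨c, hc, h⟩ := exists_torusPt_rep v hv
  rw [h, hF.smul_eq hc hv]
  simp [hc, zpow_ne_zero]

end TorusPoints

/-- Let `y ↦ y ^ M` map the points of `X` with nonzero coordinates onto those of `Y`, with the
`G`-orbits as fibres. Then it is birationally the quotient by `G`. Openness and the descent of
regular functions both come from the decomposition `IsLaurent.exists_descent` and the independence of
its monomials on the kernel. -/
theorem birationalToQuotient_monMap {n k : ℕ} [NeZero n] [NeZero k] {X : Set (PSpace n)}
    {Y : Set (PSpace k)} [Nonempty Y] (f : X →. Y) (G : Subgroup (Aut X))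
    (M : Matrix (Fin k) (Fin n) ℤ) {s : ℤ} (hs : s ≠ 0) (hM : ∀ j, ∑ i, M j i = s)
    (hXd : Dense {p : X | ∀ i, p.1.rep i ≠ 0}) (hYd : Dense {q : Y | ∀ i, q.1.rep i ≠ 0})
    (hXY : ∀ v (hv : ∀ i, v i ≠ 0),
      torusPt v hv ∈ X ↔ torusPt (monMap M v) (monMap_ne_zero M hv) ∈ Y)
    (hf : ∀ (p : X) (hp : ∀ i, p.1.rep i ≠ 0), ∃ q ∈ f p,
      q.1 = torusPt (monMap M p.1.rep) (monMap_ne_zero M hp))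
    (hsurj : ∀ q : Y, (∀ i, q.1.rep i ≠ 0) →
      ∃ v, ∃ hv : ∀ i, v i ≠ 0, torusPt (monMap M v) (monMap_ne_zero M hv) = q.1)
    (hG : ∀ g ∈ G, ∀ p : X, (∀ i, p.1.rep i ≠ 0) → ∀ i, ((g : Equiv.Perm X) p).1.rep i ≠ 0)
    (hfib : ∀ (p p' : X) (hp : ∀ i, p.1.rep i ≠ 0) (hp' : ∀ i, p'.1.rep i ≠ 0),
      torusPt (monMap M p.1.rep) (monMap_ne_zero M hp) =
        torusPt (monMap M p'.1.rep) (monMap_ne_zero M hp') ↔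
      ∃ g ∈ G, (g : Equiv.Perm X) p = p') :
    BirationalToQuotient f G := by
  classical
  have hmem : ∀ (p : X) (hp : ∀ i, p.1.rep i ≠ 0),
      torusPt (monMap M p.1.rep) (monMap_ne_zero M hp) ∈ Y := fun p hp => by
    rw [← hXY _ hp, torusPt_rep]
    exact p.2
  let φ : X → Y := fun p =>
    if hp : ∀ i, p.1.rep i ≠ 0 then ⟨_, hmem p hp⟩ else Classical.arbitrary Y
  have hφ : ∀ (p : X) (hp : ∀ i, p.1.rep i ≠ 0),
      (φ p).1 = torusPt (monMap M p.1.rep) (monMap_ne_zero M hp) := fun p hp => by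
    simp only [φ, dif_pos hp]
  have hφ' : ∀ v (hv : ∀ i, v i ≠ 0) (hX : torusPt v hv ∈ X),
      (φ ⟨torusPt v hv, hX⟩).1 = torusPt (monMap M v) (monMap_ne_zero M hv) := fun v hv hX => by
    rw [hφ _ (torusPt_rep_ne_zero v hv)]
    exact torusPt_monMap_eq hM (hv := torusPt_rep_ne_zero v hv) (hw := hv)
      (torusPt_rep (torusPt_rep_ne_zero v hv))
  have hφT : ∀ p : X, (∀ i, p.1.rep i ≠ 0) → ∀ i, (φ p).1.rep i ≠ 0 := fun p hp => by
    rw [hφ p hp]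
    exact torusPt_rep_ne_zero _ _
  have hφ0 : ∀ {d : ℤ} {P : (Fin k → ℂ) → ℂ}, IsLaurent d P → ∀ p : X, (∀ i, p.1.rep i ≠ 0) →
      (P (φ p).1.rep = 0 ↔ P (monMap M p.1.rep) = 0) := fun hP p hp => by
    rw [hφ p hp]
    exact hP.rep_torusPt_eq_zero_iff _
  -- translates of a point of `X` by the kernel of the monomial map stay in `X`
  have hKX : ∀ v (hv : ∀ i, v i ≠ 0), torusPt (monMap M v) (monMap_ne_zero M hv) ∈ Y →
      ∀ c (hc : ∀ i, c i ≠ 0), monMap M c = 1 →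
      torusPt (v * c) (fun i => mul_ne_zero (hv i) (hc i)) ∈ X := fun v hv hX c hc hcM => by
    rw [hXY]
    have : monMap M (v * c) = monMap M v := by rw [monMap_mul, hcM, mul_one]
    convert hX using 2
  refine birationalToQuotient_of_isOpen f G φ {p | ∀ i, p.1.rep i ≠ 0} {q | ∀ i, q.1.rep i ≠ 0}
    isOpen_torus hXd isOpen_torus hYd ?_ hφT ?_ ?_ ?_ hG ?_ ?_
  · intro p hp
    obtain ⟨q, hq, h⟩ := hf p hp
    rwa [show φ p = q from Subtype.ext ((hφ p hp).trans h.symm)]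
  · intro q hq
    obtain ⟨v, hv, h⟩ := hsurj q hq
    have hX : torusPt v hv ∈ X := by
      rw [hXY, h]
      exact q.2
    exact ⟨⟨_, hX⟩, torusPt_rep_ne_zero v hv, Subtype.ext ((hφ' v hv hX).trans h)⟩
  · intro p hp W hW
    obtain ⟨d, h, hh, hhp, H⟩ := (mem_nhds_iff_isLaurent (hφT p hp)).1 hW
    refine (mem_nhds_iff_isLaurent hp).2 ⟨_, _, hh.comp_monMap hM, ?_, fun q hq hhq => ?_⟩
    · exact fun h0 => hhp ((hφ0 hh p hp).2 h0)
    · exact H _ (hφT q hq) fun h0 => hhq ((hφ0 hh q hq).1 h0)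
  · -- the image of `h ≠ 0` contains the nonvanishing locus of each component `P q` of `h`
    intro W hWU hW
    rw [isOpen_iff_mem_nhds]
    rintro _ ⟨p, hpW, rfl⟩
    have hp := hWU hpW
    obtain ⟨d, h, hh, hhp, H⟩ := (mem_nhds_iff_isLaurent hp).1 (hW.mem_nhds hpW)
    obtain ⟨I, D, P, _, hP, _, hsum⟩ := hh.exists_descent hs hM hh
    rw [(hsum _ hp).1] at hhp
    obtain ⟨q, hqI, hq⟩ := Finset.exists_ne_zero_of_sum_ne_zero hhp
    refine (mem_nhds_iff_isLaurent (hφT p hp)).2 ⟨D q, P q, hP q, ?_, fun z hz hPz => ?_⟩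
    · exact fun h0 => right_ne_zero_of_mul hq ((hφ0 (hP q) p hp).1 h0)
    · obtain ⟨v, hv, hvz⟩ := hsurj z hz
      have hPv : P q (monMap M v) ≠ 0 := fun h0 => hPz (by
        rw [← hvz]
        exact ((hP q).rep_torusPt_eq_zero_iff _).2 h0)
      obtain ⟨c, hc, hcM, hcne⟩ : ∃ c : Fin n → ℂ, (∀ i, c i ≠ 0) ∧ monMap M c = 1 ∧
          ∑ q ∈ I, (mon q.out v * P q (monMap M v)) * mon q.out c ≠ 0 := by
        by_contra! hcon
        exact mul_ne_zero (mon_ne_zero _ hv) hPv (eq_zero_of_sum_mon_out_eq_zero I _ hcon q hqI)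
      have hvc : ∀ i, (v * c) i ≠ 0 := fun i => mul_ne_zero (hv i) (hc i)
      have hX := hKX v hv (hvz ▸ z.2) c hc hcM
      have hval : h (v * c) ≠ 0 := by
        rw [(hsum _ hvc).1, monMap_mul, hcM, mul_one]
        refine fun h0 => hcne ((Finset.sum_congr rfl fun r _ => ?_).trans h0)
        rw [mon_mul]
        ring
      refine ⟨⟨_, hX⟩, H _ (torusPt_rep_ne_zero _ hvc) ?_, Subtype.ext ?_⟩
      · exact fun h0 => hval ((hh.rep_torusPt_eq_zero_iff hvc).1 h0)
      · rw [hφ' _ hvc hX, ← hvz]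
        have : monMap M (v * c) = monMap M v := by rw [monMap_mul, hcM, mul_one]
        congr 1
  · intro p hp p' hp'
    rw [← hfib p p' hp hp', ← hφ p hp, ← hφ p' hp', Subtype.ext_iff]
  · intro F p hp
    rw [regularAt_iff_isLaurent (hφT p hp), regularAt_iff_isLaurent hp]
    have hFeq : ∀ {d : ℤ} {g h : (Fin k → ℂ) → ℂ}, IsLaurent d g → IsLaurent d h →
        ∀ (z : Y) (v : Fin k → ℂ) (hv : ∀ i, v i ≠ 0), z.1 = torusPt v hv →
        (F z * h z.1.rep = g z.1.rep ↔ F z * h v = g v) := by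
      intro d g h hg hh z v hv hz
      obtain ⟨c, hc, hcr⟩ := exists_torusPt_rep v hv
      rw [← hz] at hcr
      rw [hcr, hg.smul_eq hc hv, hh.smul_eq hc hv, mul_left_comm,
        mul_right_inj' (zpow_ne_zero d hc)]
    constructor
    · rintro ⟨d, g, h, hg, hh, hhp, H⟩
      refine ⟨_, _, _, hg.comp_monMap hM, hh.comp_monMap hM, ?_, fun q hq => ?_⟩
      · exact fun h0 => hhp ((hφ0 hh p hp).2 h0)
      · exact (hFeq hg hh _ _ (monMap_ne_zero M hq) (hφ q hq)).1 (H _ (hφT q hq))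
    · -- compare the components of `F h = g` in a class where the denominator does not vanish
      rintro ⟨d, g, h, hg, hh, hhp, H⟩
      obtain ⟨I, D, P, Q, hP, hQ, hsum⟩ := hg.exists_descent hs hM hh
      rw [(hsum _ hp).2] at hhp
      obtain ⟨q, hqI, hq⟩ := Finset.exists_ne_zero_of_sum_ne_zero hhp
      refine ⟨D q, P q, Q q, hP q, hQ q, ?_, fun z hz => ?_⟩
      · exact fun h0 => right_ne_zero_of_mul hq ((hφ0 (hQ q) p hp).1 h0)
      · obtain ⟨v, hv, hvz⟩ := hsurj z hz
        rw [hFeq (hP q) (hQ q) z _ (monMap_ne_zero M hv) hvz.symm]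
        have hzero := eq_zero_of_sum_mon_out_eq_zero (M := M) I
          (fun q => mon q.out v * (F z * Q q (monMap M v) - P q (monMap M v))) (by
            intro c hc hcM
            have hvc : ∀ i, (v * c) i ≠ 0 := fun i => mul_ne_zero (hv i) (hc i)
            have hX := hKX v hv (hvz ▸ z.2) c hc hcM
            have hM' : monMap M (v * c) = monMap M v := by rw [monMap_mul, hcM, mul_one]
            have hφz : φ ⟨_, hX⟩ = z := Subtype.ext (by
              rw [hφ' _ hvc hX, ← hvz]
              congr 1)
            have h1 := H ⟨_, hX⟩ (torusPt_rep_ne_zero _ hvc)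
            simp only [hφz] at h1
            obtain ⟨a, ha, har⟩ := exists_torusPt_rep _ hvc
            rw [har, hg.smul_eq ha hvc, hh.smul_eq ha hvc, mul_left_comm,
              mul_right_inj' (zpow_ne_zero d ha), (hsum _ hvc).1, (hsum _ hvc).2, hM',
              Finset.mul_sum, ← sub_eq_zero, ← Finset.sum_sub_distrib] at h1
            rw [← h1]
            refine Finset.sum_congr rfl fun r _ => ?_
            rw [mon_mul]
            ring) q hqI
        exact sub_eq_zero.1 ((mul_eq_zero.1 hzero).resolve_left (mon_ne_zero _ hv))

/-! ### The matrix `B` -/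

section MatB

variable {n : ℕ} {A : Matrix (Fin n) (Fin n) ℕ}

/-- `A` viewed as an integer matrix. -/
def intMatrix (A : Matrix (Fin n) (Fin n) ℕ) : Matrix (Fin n) (Fin n) ℤ := A.map Nat.cast

theorem ratMatrix_eq_map (A : Matrix (Fin n) (Fin n) ℕ) :
    ratMatrix A = (intMatrix A).map (Int.castRingHom ℚ) := by
  ext i j
  simp [ratMatrix, intMatrix]

/-- `|det A|` is a common denominator of `A⁻¹`, so that `d` is attained. -/
theorem dNum_spec (hdet : (ratMatrix A).det ≠ 0) :
    0 < dNum A ∧ ∀ i j, ∃ b : ℤ, (dNum A : ℚ) * (ratMatrix A)⁻¹ i j = (b : ℚ) := by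
  refine Nat.sInf_mem (s := {d : ℕ | 0 < d ∧ ∀ i j, ∃ b : ℤ,
    (d : ℚ) * (ratMatrix A)⁻¹ i j = (b : ℚ)}) ?_
  have hd : (ratMatrix A).det = ((intMatrix A).det : ℚ) := by
    rw [ratMatrix_eq_map, ← RingHom.mapMatrix_apply, ← RingHom.map_det]
    rfl
  have hz : (intMatrix A).det ≠ 0 := fun h => hdet (by rw [hd, h, Int.cast_zero])
  refine ⟨(intMatrix A).det.natAbs, Int.natAbs_pos.2 hz, fun i j => ?_⟩
  have hadj : (ratMatrix A).adjugate i j = ((intMatrix A).adjugate i j : ℚ) := by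
    rw [ratMatrix_eq_map, ← RingHom.mapMatrix_apply, ← RingHom.map_adjugate]
    rfl
  rw [Matrix.inv_def, Matrix.smul_apply, Ring.inverse_eq_inv', smul_eq_mul, hadj, hd,
    Nat.cast_natAbs]
  have hz' : ((intMatrix A).det : ℚ) ≠ 0 := by exact_mod_cast hz
  rcases abs_choice (intMatrix A).det with h | h
  · exact ⟨(intMatrix A).adjugate i j, by rw [h, mul_inv_cancel_left₀ hz']⟩
  · refine ⟨-(intMatrix A).adjugate i j, ?_⟩
    rw [h, Int.cast_neg, Int.cast_neg, neg_mul, mul_inv_cancel_left₀ hz']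

theorem matB_map (hdet : (ratMatrix A).det ≠ 0) :
    (matB A).map (Int.castRingHom ℚ) = (dNum A : ℚ) • (ratMatrix A)⁻¹ := by
  ext i j
  obtain ⟨b, hb⟩ := (dNum_spec hdet).2 i j
  simp [matB, hb]

theorem matB_mul (hdet : (ratMatrix A).det ≠ 0) :
    matB A * intMatrix A = (dNum A : ℤ) • (1 : Matrix (Fin n) (Fin n) ℤ) := by
  have hu : IsUnit (ratMatrix A).det := isUnit_iff_ne_zero.2 hdet
  apply Matrix.map_injective (Int.castRingHom ℚ).injective_int
  beta_reduce
  rw [Matrix.map_mul, matB_map hdet, ← ratMatrix_eq_map, Matrix.smul_mul,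
    Matrix.nonsing_inv_mul _ hu]
  ext i j
  simp only [Matrix.smul_apply, Matrix.map_apply, Matrix.one_apply, smul_eq_mul]
  split_ifs <;> simp

theorem mul_matB (hdet : (ratMatrix A).det ≠ 0) :
    intMatrix A * matB A = (dNum A : ℤ) • (1 : Matrix (Fin n) (Fin n) ℤ) := by
  have hu : IsUnit (ratMatrix A).det := isUnit_iff_ne_zero.2 hdet
  apply Matrix.map_injective (Int.castRingHom ℚ).injective_int
  beta_reduce
  rw [Matrix.map_mul, matB_map hdet, ← ratMatrix_eq_map, Matrix.mul_smul,
    Matrix.mul_nonsing_inv _ hu]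
  ext i j
  simp only [Matrix.smul_apply, Matrix.map_apply, Matrix.one_apply, smul_eq_mul]
  split_ifs <;> simp

theorem mul_sum_matB_row (hrow : ∀ i, ∑ j, A i j = n) (hdet : (ratMatrix A).det ≠ 0) (i : Fin n) :
    (∑ j, matB A i j) * n = dNum A := by
  have h := congrFun (congrArg (fun M => Matrix.mulVec M 1) (matB_mul hdet)) i
  have hA : Matrix.mulVec (intMatrix A) 1 = fun _ => (n : ℤ) := by
    ext i
    simp only [Matrix.mulVec, dotProduct, intMatrix, Matrix.map_apply, Pi.one_apply, mul_one]
    exact_mod_cast hrow i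
  rw [← Matrix.mulVec_mulVec, hA] at h
  simpa [Matrix.mulVec, dotProduct, Finset.sum_mul, Matrix.one_apply, Matrix.smul_apply] using h

theorem mul_sum_matB_col (hcol : ∀ j, ∑ i, A i j = n) (hdet : (ratMatrix A).det ≠ 0) (j : Fin n) :
    n * (∑ i, matB A i j) = dNum A := by
  have h := congrFun (congrArg (fun M => Matrix.vecMul 1 M) (mul_matB hdet)) j
  have hA : Matrix.vecMul 1 (intMatrix A) = fun _ => (n : ℤ) := by
    ext i
    simp only [Matrix.vecMul, dotProduct, intMatrix, Matrix.map_apply, Pi.one_apply, one_mul]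
    exact_mod_cast hcol i
  rw [← Matrix.vecMul_vecMul, hA] at h
  simpa [Matrix.vecMul, dotProduct, Finset.mul_sum, Matrix.one_apply, Matrix.smul_apply] using h

theorem mul_mNum [NeZero n] (hrow : ∀ i, ∑ j, A i j = n) (hdet : (ratMatrix A).det ≠ 0) :
    n * mNum A = dNum A := by
  refine Nat.mul_div_cancel' ?_
  have : (n : ℤ) ∣ dNum A := ⟨_, ((mul_comm _ _).trans (mul_sum_matB_row hrow hdet 0)).symm⟩
  exact_mod_cast this

theorem sum_matB_row [NeZero n] (hrow : ∀ i, ∑ j, A i j = n) (hdet : (ratMatrix A).det ≠ 0)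
    (i : Fin n) : ∑ j, matB A i j = mNum A := by
  have h := mul_sum_matB_row hrow hdet i
  rw [← mul_mNum hrow hdet] at h
  push_cast at h
  rw [mul_comm] at h
  exact mul_left_cancel₀ (by exact_mod_cast NeZero.ne n) h

theorem sum_matB_col [NeZero n] (hrow : ∀ i, ∑ j, A i j = n) (hcol : ∀ j, ∑ i, A i j = n)
    (hdet : (ratMatrix A).det ≠ 0) (j : Fin n) : ∑ i, matB A i j = mNum A := by
  have h := mul_sum_matB_col hcol hdet j
  rw [← mul_mNum hrow hdet] at h
  push_cast at h
  exact mul_left_cancel₀ (by exact_mod_cast NeZero.ne n) h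

theorem mNum_pos [NeZero n] (hrow : ∀ i, ∑ j, A i j = n) (hdet : (ratMatrix A).det ≠ 0) :
    0 < mNum A := by
  have h := (dNum_spec hdet).1
  rw [← mul_mNum hrow hdet] at h
  exact Nat.pos_of_mul_pos_left h

end MatB

/-! ### Diagonal automorphisms -/

section Diag

variable {n : ℕ}

theorem mul_ne_zero_of_units {v : Fin n → ℂ} (hv : v ≠ 0) (c : Fin n → ℂˣ) :
    (fun i => (c i : ℂ) * v i) ≠ 0 := fun h => hv (funext fun i => by
  simpa using congrFun h i)

theorem diagMap_mk (c : Fin n → ℂˣ) (v : Fin n → ℂ) (hv : v ≠ 0) :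
    diagMap c (Projectivization.mk ℂ v hv) =
      Projectivization.mk ℂ (fun i => (c i : ℂ) * v i) (mul_ne_zero_of_units hv c) := rfl

theorem diagMap_one (p : PSpace n) : diagMap 1 p = p := by
  induction p using Projectivization.ind with
  | h v hv => simp [diagMap_mk]

theorem diagMap_mul (c c' : Fin n → ℂˣ) (p : PSpace n) :
    diagMap (c * c') p = diagMap c (diagMap c' p) := by
  induction p using Projectivization.ind with
  | h v hv => simp [diagMap_mk, mul_assoc]

theorem diagMap_const (u : ℂˣ) (p : PSpace n) : diagMap (fun _ => u) p = p := by
  induction p using Projectivization.ind with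
  | h v hv =>
    rw [diagMap_mk, Projectivization.mk_eq_mk_iff']
    exact ⟨u, by ext i; simp⟩

theorem exists_rep_diagMap (c : Fin n → ℂˣ) (p : PSpace n) :
    ∃ a : ℂ, a ≠ 0 ∧ (diagMap c p).rep = a • fun i => (c i : ℂ) * p.rep i := by
  conv in diagMap c p => rw [← p.mk_rep]
  rw [diagMap_mk]
  exact exists_rep_eq_smul _

theorem exists_isHomogeneous_diag (c : Fin n → ℂˣ) {k : ℕ} {g : MvPolynomial (Fin n) ℂ}
    (hg : g.IsHomogeneous k) : ∃ g' : MvPolynomial (Fin n) ℂ, g'.IsHomogeneous k ∧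
      ∀ v, eval v g' = eval (fun i => (c i : ℂ) * v i) g := by
  refine ⟨aeval (fun i => C (c i : ℂ) * X i) g, ?_, fun v => ?_⟩
  · have := hg.aeval (n := 1) (fun i => C (c i : ℂ) * X i) fun i => by
      simpa using (isHomogeneous_C (Fin n) (c i : ℂ)).mul (isHomogeneous_X ℂ i)
    simpa using this
  · rw [← coe_aeval_eq_eval, ← coe_aeval_eq_eval, RingHom.coe_coe, RingHom.coe_coe,
      ← AlgHom.comp_apply, comp_aeval]
    simp

/-- The diagonal transformations which preserve `X`. -/
def diagStab (X : Set (PSpace n)) : Subgroup (Fin n → ℂˣ) where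
  carrier := {c | ∀ p, diagMap c p ∈ X ↔ p ∈ X}
  one_mem' p := by rw [diagMap_one]
  mul_mem' := by
    intro a b ha hb p
    rw [diagMap_mul, ha, hb]
  inv_mem' := by
    intro a ha p
    rw [← ha, ← diagMap_mul, mul_inv_cancel, diagMap_one]

/-- A diagonal transformation preserving `X`, as a permutation of `X`. -/
noncomputable def diagPerm (X : Set (PSpace n)) : diagStab X →* Equiv.Perm X where
  toFun c :=
    { toFun := fun p => ⟨diagMap c.1 p.1, (c.2 p.1).2 p.2⟩
      invFun := fun p => ⟨diagMap (c⁻¹).1 p.1, ((c⁻¹).2 p.1).2 p.2⟩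
      left_inv := fun p => Subtype.ext (by
        change diagMap _ (diagMap _ _) = _
        rw [← diagMap_mul, ← Subgroup.coe_mul, inv_mul_cancel, Subgroup.coe_one, diagMap_one])
      right_inv := fun p => Subtype.ext (by
        change diagMap _ (diagMap _ _) = _
        rw [← diagMap_mul, ← Subgroup.coe_mul, mul_inv_cancel, Subgroup.coe_one, diagMap_one]) }
  map_one' := Equiv.ext fun p => Subtype.ext (diagMap_one p.1)
  map_mul' a b := Equiv.ext fun p => Subtype.ext (diagMap_mul a.1 b.1 p.1)

theorem diagPerm_apply (X : Set (PSpace n)) (c : diagStab X) (p : X) :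
    (diagPerm X c p).1 = diagMap c.1 p.1 := rfl

theorem continuous_diagPerm (X : Set (PSpace n)) (c : diagStab X) : Continuous (diagPerm X c) := by
  refine continuous_iff_continuousAt.2 fun p W hW => ?_
  obtain ⟨k, u, hu, hup, H⟩ := mem_nhds_coe_iff.1 hW
  obtain ⟨u', hu', h⟩ := exists_isHomogeneous_diag c.1 hu
  have key : ∀ q : X, eval (diagPerm X c q).1.rep u = 0 ↔ eval q.1.rep u' = 0 := fun q => by
    obtain ⟨a, ha, hq⟩ := exists_rep_diagMap c.1 q.1
    rw [diagPerm_apply, hq, eval_smul_of_isHomogeneous hu, h]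
    simp [ha]
  exact mem_nhds_coe_iff.2 ⟨k, u', hu', fun h0 => hup ((key p).2 h0),
    fun q hq => H _ fun h0 => hq ((key q).1 h0)⟩

theorem regularAt_diagPerm (X : Set (PSpace n)) (c : diagStab X) {F : X → ℂ} {p : X}
    (hF : RegularAt F (diagPerm X c p)) : RegularAt (fun q => F (diagPerm X c q)) p := by
  obtain ⟨k, g, h, hg, hh, hp, H⟩ := regularAt_coe_iff.1 hF
  obtain ⟨g', hg', hgv⟩ := exists_isHomogeneous_diag c.1 hg
  obtain ⟨h', hh', hhv⟩ := exists_isHomogeneous_diag c.1 hh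
  refine regularAt_coe_iff.2 ⟨k, g', h', hg', hh', ?_, fun q => ?_⟩
  · obtain ⟨a, ha, hq⟩ := exists_rep_diagMap c.1 p.1
    rw [diagPerm_apply, hq, eval_smul_of_isHomogeneous hh, ← hhv] at hp
    exact right_ne_zero_of_mul hp
  · obtain ⟨a, ha, hq⟩ := exists_rep_diagMap c.1 q.1
    have := H (diagPerm X c q)
    rw [diagPerm_apply, hq, eval_smul_of_isHomogeneous hh, eval_smul_of_isHomogeneous hg, ← hhv,
      ← hgv, mul_left_comm] at this
    exact mul_left_cancel₀ (pow_ne_zero k ha) this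

/-- The action of the diagonal transformations preserving `X` by automorphisms of `X`. -/
noncomputable def diagAut (X : Set (PSpace n)) : diagStab X →* Aut X :=
  (diagPerm X).codRestrict (Aut X) fun c => by
    have hinv : (diagPerm X c).symm = diagPerm X c⁻¹ := (map_inv (diagPerm X) c).symm
    refine ⟨continuous_diagPerm X c, hinv ▸ continuous_diagPerm X c⁻¹, fun F p =>
      ⟨regularAt_diagPerm X c, fun h => ?_⟩⟩
    have h2 := regularAt_diagPerm X c⁻¹ (p := diagPerm X c p)
      (F := fun q => F (diagPerm X c q)) (by rwa [← hinv, Equiv.symm_apply_apply])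
    simpa only [← hinv, Equiv.apply_symm_apply] using h2

end Diag

/-! ### Roots of unity and the group `Γ_d` -/

section Zeta

variable {d n : ℕ}

/-- `ζ ^ a` for `a ∈ ℤ/d`. -/
noncomputable def zetaPow (a : ZMod d) : ℂˣ := zeta d ^ a.val

theorem zetaPow_zero : zetaPow (0 : ZMod d) = 1 := by simp [zetaPow]

/-- The vector `(ζ ^ a₁, …, ζ ^ aₙ)`. -/
noncomputable def zetaVec (a : Fin n → ZMod d) : Fin n → ℂ := fun i => (zetaPow (a i) : ℂ)

theorem zetaVec_ne_zero (a : Fin n → ZMod d) : ∀ i, zetaVec a i ≠ 0 := fun _ => Units.ne_zero _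

variable [NeZero d]

theorem isPrimitiveRoot_zeta (d : ℕ) [NeZero d] : IsPrimitiveRoot (zeta d) d :=
  IsPrimitiveRoot.coe_units_iff.1 (Complex.isPrimitiveRoot_exp d (NeZero.ne d))

theorem zetaPow_intCast (z : ℤ) : zetaPow (z : ZMod d) = zeta d ^ z := by
  rw [zetaPow, ← zpow_natCast, ZMod.val_intCast, (isPrimitiveRoot_zeta d).eq_orderOf,
    ← (isPrimitiveRoot_zeta d).eq_orderOf, ← zpow_mod_orderOf (zeta d) z,
    ← (isPrimitiveRoot_zeta d).eq_orderOf]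

theorem zetaPow_add (a b : ZMod d) : zetaPow (a + b) = zetaPow a * zetaPow b := by
  obtain ⟨x, rfl⟩ := ZMod.intCast_surjective a
  obtain ⟨y, rfl⟩ := ZMod.intCast_surjective b
  rw [← Int.cast_add, zetaPow_intCast, zetaPow_intCast, zetaPow_intCast, zpow_add]

theorem zetaPow_intCast_mul (z : ℤ) (a : ZMod d) :
    zetaPow ((z : ZMod d) * a) = zetaPow a ^ z := by
  obtain ⟨x, rfl⟩ := ZMod.intCast_surjective a
  rw [← Int.cast_mul, zetaPow_intCast, zetaPow_intCast, mul_comm, zpow_mul]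

theorem zetaPow_natCast_mul (z : ℕ) (a : ZMod d) :
    zetaPow ((z : ZMod d) * a) = zetaPow a ^ z := by
  exact_mod_cast zetaPow_intCast_mul (z : ℤ) a

theorem zetaPow_sum {ι : Type*} (s : Finset ι) (a : ι → ZMod d) :
    zetaPow (∑ i ∈ s, a i) = ∏ i ∈ s, zetaPow (a i) := by
  classical
  induction s using Finset.induction_on with
  | empty => simp [zetaPow_zero]
  | insert i s hi ih => rw [Finset.sum_insert hi, Finset.prod_insert hi, zetaPow_add, ih]

theorem zetaPow_eq_one_iff {a : ZMod d} : zetaPow a = 1 ↔ a = 0 := by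
  rw [zetaPow, (isPrimitiveRoot_zeta d).pow_eq_one_iff_dvd]
  refine ⟨fun h => ?_, fun h => by simp [h]⟩
  rw [← ZMod.natCast_zmod_val a]
  exact (ZMod.natCast_eq_zero_iff _ _).2 h

theorem zetaPow_injective : Function.Injective (zetaPow (d := d)) := by
  intro a b h
  have : zetaPow (a - b) = 1 := by
    rw [← mul_left_inj (zetaPow b), ← zetaPow_add, sub_add_cancel, h, one_mul]
  exact sub_eq_zero.1 (zetaPow_eq_one_iff.1 this)

theorem zetaPow_pow (a : ZMod d) : zetaPow a ^ d = 1 := by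
  rw [← zetaPow_natCast_mul, ZMod.natCast_self, zero_mul, zetaPow_zero]

theorem exists_zetaPow_eq {u : ℂˣ} (hu : u ^ d = 1) : ∃ a : ZMod d, zetaPow a = u := by
  obtain ⟨i, hi, h⟩ := (isPrimitiveRoot_zeta d).eq_pow_of_mem_rootsOfUnity
    ((mem_rootsOfUnity d u).2 hu)
  exact ⟨(i : ZMod d), by rw [zetaPow, ZMod.val_natCast_of_lt hi, h]⟩

theorem mon_zetaVec (e : Fin n → ℤ) (a : Fin n → ZMod d) :
    mon e (zetaVec a) = (zetaPow (∑ i, (e i : ZMod d) * a i) : ℂ) := by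
  simp only [mon, zetaVec, zetaPow_sum, zetaPow_intCast_mul, Units.coe_prod,
    Units.val_zpow_eq_zpow_val]

/-- If `n m = d`, the condition `∑ aᵢ ≡ 0 mod n` means `m ∑ aᵢ = 0` in `ℤ/d`. -/
theorem mem_sumZero_iff {m : ℕ} (hm : n * m = d) (a : Fin n → ZMod d) :
    a ∈ sumZero n d ↔ (m : ZMod d) * ∑ i, a i = 0 := by
  change (n : ZMod d) ∣ ∑ i, a i ↔ _
  constructor
  · rintro ⟨c, hc⟩
    rw [hc, ← mul_assoc, mul_comm (m : ZMod d), ← Nat.cast_mul, hm, ZMod.natCast_self, zero_mul]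
  · intro h
    have hm0 : 0 < m := Nat.pos_of_ne_zero fun h0 => NeZero.ne d (by rw [← hm, h0, mul_zero])
    rw [← ZMod.natCast_zmod_val (∑ i, a i)] at h ⊢
    rw [← Nat.cast_mul, ZMod.natCast_eq_zero_iff] at h
    have h' : m * n ∣ m * (∑ i, a i).val := by rwa [mul_comm m n, hm]
    exact Nat.cast_dvd_cast (Nat.dvd_of_mul_dvd_mul_left hm0 h')

/-- A homomorphism `τ` on `(ℤ/d)ⁿ` such that the `g_{τ a}` preserve `X`, and such that `τ` maps
`(1, …, 1)` to a scalar vector, induces an action of `Γ_d` on `X`. -/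
theorem exists_gamHom {X : Set (PSpace n)} (τ : (Fin n → ZMod d) →+ (Fin n → ZMod d))
    (hτ : ∀ a ∈ sumZero n d, (fun i => zetaPow (τ a i)) ∈ diagStab X)
    (hone : ∃ b : ZMod d, τ (fun _ => 1) = fun _ => b) :
    ∃ α : Gam n d →* Aut X, ∀ (a : sumZero n d) (p : X),
      (((α (Gam.mk a)).1 p : X) : PSpace n) = gMap (τ a.1) p := by
  let β₀ : Multiplicative (sumZero n d) →* diagStab X :=
    { toFun := fun a => ⟨_, hτ _ a.toAdd.2⟩
      map_one' := Subtype.ext (funext fun i => by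
        change zetaPow (τ 0 i) = 1
        rw [map_zero, Pi.zero_apply, zetaPow_zero])
      map_mul' := fun a b => Subtype.ext (funext fun i => by
        change zetaPow (τ (_ + _) i) = _
        rw [map_add, Pi.add_apply, zetaPow_add]
        rfl) }
  let β : sumZero n d →+ Additive (Aut X) :=
    AddMonoidHom.toMultiplicativeLeft.symm ((diagAut X).comp β₀)
  have hβ : ∀ (a : sumZero n d) (p : X),
      ((((β a).toMul : Aut X) : Equiv.Perm X) p : PSpace n) = gMap (τ a.1) p := fun a p => rfl
  have hker : ∀ a ∈ (AddSubgroup.zmultiples (fun _ : Fin n => (1 : ZMod d))).addSubgroupOf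
      (sumZero n d), β a = 0 := by
    intro a ha
    obtain ⟨z, hz⟩ := AddSubgroup.mem_zmultiples_iff.1 (AddSubgroup.mem_addSubgroupOf.1 ha)
    obtain ⟨b, hb⟩ := hone
    refine Additive.toMul.injective (Subtype.ext (Equiv.ext fun p => Subtype.ext ?_))
    rw [hβ, ← hz, map_zsmul, hb]
    exact diagMap_const (zeta d ^ (z • b).val) p.1
  exact ⟨AddMonoidHom.toMultiplicativeLeft (QuotientAddGroup.lift _ β hker), fun a p => hβ a p⟩

end Zeta

/-! ### Equations of the varieties -/

section Equations

variable {n : ℕ}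

theorem mk_mem_projZeros_iff {S : Set (MvPolynomial (Fin n) ℂ)}
    (hS : ∀ F ∈ S, ∃ k, F.IsHomogeneous k) {v : Fin n → ℂ} (hv : v ≠ 0) :
    Projectivization.mk ℂ v hv ∈ projZeros S ↔ ∀ F ∈ S, eval v F = 0 := by
  refine forall₂_congr fun F hF => ?_
  obtain ⟨k, hk⟩ := hS F hF
  exact eval_rep_mk_eq_zero_iff hk hv

/-- The exponents of `q_A`: the first row is `(1, …, 1)`, below it stands `A`. -/
def extMatrix (A : Matrix (Fin n) (Fin n) ℕ) : Matrix (Fin (n + 1)) (Fin n) ℤ :=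
  Matrix.of (Fin.cons (fun _ => 1) fun i j => (A i j : ℤ))

/-- The exponents of `q_A ∘ φ_A`: the first row is `(m, …, m)`, below it stands `d I`. -/
noncomputable def compMatrix (A : Matrix (Fin n) (Fin n) ℕ) : Matrix (Fin (n + 1)) (Fin n) ℤ :=
  Matrix.of (Fin.cons (fun _ => (mNum A : ℤ)) fun i => Pi.single i (dNum A : ℤ))

variable {A : Matrix (Fin n) (Fin n) ℕ}

theorem extMatrix_zero (j : Fin n) : extMatrix A 0 j = 1 := rfl

theorem extMatrix_succ (i j : Fin n) : extMatrix A i.succ j = A i j := rfl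

theorem compMatrix_zero (j : Fin n) : compMatrix A 0 j = mNum A := rfl

theorem compMatrix_succ (i : Fin n) : compMatrix A i.succ = Pi.single i (dNum A : ℤ) := rfl

theorem monMap_extMatrix (v : Fin n → ℂ) :
    monMap (extMatrix A) v = Fin.cons (∏ j, v j) fun i => ∏ j, v j ^ A i j := by
  funext j
  refine Fin.cases ?_ (fun i => ?_) j
  · simp [monMap, extMatrix_zero, mon]
  · simp [monMap, extMatrix_succ, mon]

theorem mon_single (i : Fin n) (d : ℕ) (v : Fin n → ℂ) :
    mon (Pi.single i (d : ℤ)) v = v i ^ d := by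
  rw [mon, Finset.prod_eq_single i]
  · simp
  · intro j _ hj
    simp [hj]
  · simp

theorem monMap_compMatrix (v : Fin n → ℂ) :
    monMap (compMatrix A) v = Fin.cons ((∏ j, v j) ^ mNum A) fun i => v i ^ dNum A := by
  funext j
  refine Fin.cases ?_ (fun i => ?_) j
  · simp [monMap, compMatrix_zero, mon, Finset.prod_pow]
  · exact mon_single i _ v

theorem sum_extMatrix (hrow : ∀ i, ∑ j, A i j = n) (j : Fin (n + 1)) :
    ∑ i, extMatrix A j i = n := by
  refine Fin.cases ?_ (fun i => ?_) j
  · simp [extMatrix_zero]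
  · simp only [extMatrix_succ]
    exact_mod_cast hrow i

theorem isHomogeneous_polyA (hrow : ∀ i, ∑ j, A i j = n) (t : ℂ) :
    (polyA A t).IsHomogeneous n := by
  refine IsHomogeneous.sub (IsHomogeneous.sum _ _ _ fun i _ => ?_) ?_
  · have := IsHomogeneous.prod Finset.univ (fun j => (X j : MvPolynomial (Fin n) ℂ) ^ A i j) _
      fun j _ => isHomogeneous_X_pow j (A i j)
    rwa [hrow] at this
  · simpa using (isHomogeneous_C (Fin n) (n * t)).mul (isHomogeneous_prod_X n 1)

theorem mk_mem_varA_iff (hrow : ∀ i, ∑ j, A i j = n) {t : ℂ} {v : Fin n → ℂ} (hv : v ≠ 0) :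
    Projectivization.mk ℂ v hv ∈ varA A t ↔
      ∑ i : Fin n, monMap (extMatrix A) v i.succ = n * t * monMap (extMatrix A) v 0 := by
  rw [varA, mk_mem_projZeros_iff (by
    rintro F rfl
    exact ⟨n, isHomogeneous_polyA hrow t⟩), monMap_extMatrix]
  simp [polyA, sub_eq_zero]

theorem mk_mem_mirror_iff {t : ℂ} {z : Fin (n + 1) → ℂ} (hz : z ≠ 0) :
    Projectivization.mk ℂ z hz ∈ mirror n t ↔
      ∑ i : Fin n, z i.succ = n * t * z 0 ∧ z 0 ^ n = ∏ i : Fin n, z i.succ := by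
  rw [mirror, mk_mem_projZeros_iff]
  · simp [sub_eq_zero]
  · rintro F (rfl | rfl)
    · refine ⟨1, IsHomogeneous.sub (IsHomogeneous.sum _ _ _ fun i _ => isHomogeneous_X _ _) ?_⟩
      simpa using (isHomogeneous_C (Fin (n + 1)) (n * t)).mul (isHomogeneous_X ℂ 0)
    · refine ⟨n, IsHomogeneous.sub (isHomogeneous_X_pow _ _) ?_⟩
      simpa using IsHomogeneous.prod Finset.univ
        (fun i : Fin n => (X i.succ : MvPolynomial (Fin (n + 1)) ℂ)) (fun _ => 1)
        fun i _ => isHomogeneous_X _ _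

theorem monMap_extMatrix_zero_pow (hcol : ∀ j, ∑ i, A i j = n) (v : Fin n → ℂ) :
    monMap (extMatrix A) v 0 ^ n = ∏ i : Fin n, monMap (extMatrix A) v i.succ := by
  simp only [monMap_extMatrix, Fin.cons_zero, Fin.cons_succ]
  rw [Finset.prod_comm]
  simp only [Finset.prod_pow_eq_pow_sum, hcol, Finset.prod_pow]

variable [NeZero n]

theorem sum_compMatrix (hrow : ∀ i, ∑ j, A i j = n) (hdet : (ratMatrix A).det ≠ 0)
    (j : Fin (n + 1)) : ∑ i, compMatrix A j i = dNum A := by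
  refine Fin.cases ?_ (fun i => ?_) j
  · simp only [compMatrix_zero, Finset.sum_const, Finset.card_univ, Fintype.card_fin,
      nsmul_eq_mul]
    exact_mod_cast mul_mNum hrow hdet
  · simp [compMatrix_succ]

theorem extMatrix_mul_matB (hrow : ∀ i, ∑ j, A i j = n) (hcol : ∀ j, ∑ i, A i j = n)
    (hdet : (ratMatrix A).det ≠ 0) : extMatrix A * matB A = compMatrix A := by
  ext j k
  refine Fin.cases ?_ (fun i => ?_) j
  · simp only [Matrix.mul_apply, extMatrix_zero, compMatrix_zero, one_mul]
    exact sum_matB_col hrow hcol hdet k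
  · have h := congrFun (congrFun (mul_matB hdet) i) k
    simp only [Matrix.mul_apply, intMatrix, Matrix.map_apply] at h
    simp only [Matrix.mul_apply, extMatrix_succ, compMatrix_succ]
    rw [h, Matrix.smul_apply, Matrix.one_apply, Pi.single_apply, smul_eq_mul]
    simp [eq_comm]

theorem monMap_extMatrix_matB (hrow : ∀ i, ∑ j, A i j = n) (hcol : ∀ j, ∑ i, A i j = n)
    (hdet : (ratMatrix A).det ≠ 0) {v : Fin n → ℂ} (hv : ∀ i, v i ≠ 0) :
    monMap (extMatrix A) (monMap (matB A) v) = monMap (compMatrix A) v := by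
  rw [monMap_monMap _ _ hv, extMatrix_mul_matB hrow hcol hdet]

theorem isHomogeneous_polyD (hrow : ∀ i, ∑ j, A i j = n) (hdet : (ratMatrix A).det ≠ 0) (t : ℂ) :
    (polyD A t).IsHomogeneous (dNum A) := by
  refine IsHomogeneous.sub (IsHomogeneous.sum _ _ _ fun i _ => isHomogeneous_X_pow _ _) ?_
  have := (isHomogeneous_C (Fin n) (n * t)).mul (isHomogeneous_prod_X n (mNum A))
  rwa [mul_mNum hrow hdet, zero_add] at this

theorem mk_mem_varD_iff (hrow : ∀ i, ∑ j, A i j = n) (hdet : (ratMatrix A).det ≠ 0) {t : ℂ}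
    {v : Fin n → ℂ} (hv : v ≠ 0) :
    Projectivization.mk ℂ v hv ∈ varD A t ↔
      ∑ i : Fin n, monMap (compMatrix A) v i.succ = n * t * monMap (compMatrix A) v 0 := by
  rw [varD, mk_mem_projZeros_iff (by
    rintro F rfl
    exact ⟨_, isHomogeneous_polyD hrow hdet t⟩), monMap_compMatrix]
  simp [polyD, sub_eq_zero]

theorem monMap_compMatrix_zero_pow (hrow : ∀ i, ∑ j, A i j = n) (hdet : (ratMatrix A).det ≠ 0)
    (v : Fin n → ℂ) :
    monMap (compMatrix A) v 0 ^ n = ∏ i : Fin n, monMap (compMatrix A) v i.succ := by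
  simp only [monMap_compMatrix, Fin.cons_zero, Fin.cons_succ]
  rw [← pow_mul, mul_comm, mul_mNum hrow hdet, Finset.prod_pow]

theorem torusPt_mem_varA_iff (hrow : ∀ i, ∑ j, A i j = n) (hcol : ∀ j, ∑ i, A i j = n) {t : ℂ}
    (v : Fin n → ℂ) (hv : ∀ i, v i ≠ 0) :
    torusPt v hv ∈ varA A t ↔
      torusPt (monMap (extMatrix A) v) (monMap_ne_zero _ hv) ∈ mirror n t := by
  rw [torusPt, torusPt, mk_mem_varA_iff hrow, mk_mem_mirror_iff]
  exact (and_iff_left (monMap_extMatrix_zero_pow hcol v)).symm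

theorem torusPt_mem_varD_iff (hrow : ∀ i, ∑ j, A i j = n) (hdet : (ratMatrix A).det ≠ 0) {t : ℂ}
    (v : Fin n → ℂ) (hv : ∀ i, v i ≠ 0) :
    torusPt v hv ∈ varD A t ↔
      torusPt (monMap (compMatrix A) v) (monMap_ne_zero _ hv) ∈ mirror n t := by
  rw [torusPt, torusPt, mk_mem_varD_iff hrow hdet, mk_mem_mirror_iff]
  exact (and_iff_left (monMap_compMatrix_zero_pow hrow hdet v)).symm

theorem torusPt_mem_varD_iff_varA (hrow : ∀ i, ∑ j, A i j = n) (hcol : ∀ j, ∑ i, A i j = n)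
    (hdet : (ratMatrix A).det ≠ 0) {t : ℂ} (v : Fin n → ℂ) (hv : ∀ i, v i ≠ 0) :
    torusPt v hv ∈ varD A t ↔
      torusPt (monMap (matB A) v) (monMap_ne_zero _ hv) ∈ varA A t := by
  rw [torusPt_mem_varD_iff hrow hdet, torusPt_mem_varA_iff hrow hcol]
  simp only [monMap_extMatrix_matB hrow hcol hdet hv]

end Equations

/-! ### Fibres and images of the monomial maps -/

section Fibres

variable {n : ℕ} {A : Matrix (Fin n) (Fin n) ℕ}

/-- If `uⱼ ^ d = xⱼ`, then `y = u ^ A` satisfies `y ^ B = u ^ (d I) = x`. -/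
theorem exists_monMap_matB_eq (hdet : (ratMatrix A).det ≠ 0) {x : Fin n → ℂ}
    (hx : ∀ i, x i ≠ 0) : ∃ y, (∀ i, y i ≠ 0) ∧ monMap (matB A) y = x := by
  have hd := (dNum_spec hdet).1
  choose u hu using fun j => IsAlgClosed.exists_pow_nat_eq (x j) hd
  have hu0 : ∀ j, u j ≠ 0 := fun j h0 => hx j (by rw [← hu j, h0, zero_pow hd.ne'])
  refine ⟨monMap (intMatrix A) u, monMap_ne_zero _ hu0, ?_⟩
  rw [monMap_monMap _ _ hu0, matB_mul hdet]
  funext j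
  rw [← hu j, ← mon_single]
  change mon _ u = _
  congr 1
  ext i
  simp only [Matrix.smul_apply, Matrix.one_apply, Pi.single_apply, smul_eq_mul]
  simp [eq_comm]

theorem monMap_matB_zetaVec [NeZero (dNum A)] (a : Fin n → ZMod (dNum A)) :
    monMap (matB A) (zetaVec a) = zetaVec (bMul A a) := by
  funext j
  exact mon_zetaVec _ _

variable [NeZero n]

/-- The fibres of `y ↦ y ^ M` on points with nonzero coordinates are the orbits of its kernel,
though the images need only agree up to a scalar `a`: an `s`-th root of `a` absorbs it. -/
theorem torusPt_monMap_eq_iff {k : ℕ} [NeZero k] {M : Matrix (Fin k) (Fin n) ℤ} {s : ℕ}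
    (hs : s ≠ 0) (hM : ∀ j, ∑ i, M j i = s) {v w : Fin n → ℂ} (hv : ∀ i, v i ≠ 0)
    (hw : ∀ i, w i ≠ 0) :
    torusPt (monMap M v) (monMap_ne_zero M hv) = torusPt (monMap M w) (monMap_ne_zero M hw) ↔
      ∃ c, ∃ hc : ∀ i, c i ≠ 0, monMap M c = 1 ∧
        torusPt w hw = torusPt (c * v) fun i => mul_ne_zero (hc i) (hv i) := by
  constructor
  · intro h
    obtain ⟨a, ha, h⟩ := torusPt_eq_iff.1 h
    obtain ⟨μ, hμ⟩ := IsAlgClosed.exists_pow_nat_eq a (Nat.pos_of_ne_zero hs)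
    have hμ0 : μ ≠ 0 := by
      rintro rfl
      rw [zero_pow hs] at hμ
      exact ha hμ.symm
    refine ⟨fun i => w i / (μ * v i), fun i => div_ne_zero (hw i) (mul_ne_zero hμ0 (hv i)),
      ?_, torusPt_eq_iff.2 ⟨μ⁻¹, inv_ne_zero hμ0, ?_⟩⟩
    · have hw' : w = (fun i => w i / (μ * v i)) * (μ • v) := by
        ext i
        simp [div_mul_cancel₀ _ (mul_ne_zero hμ0 (hv i))]
      have h2 := congrArg (monMap M) hw'
      rw [monMap_mul, monMap_smul hM hμ0, h, zpow_natCast, hμ] at h2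
      ext j
      have h3 := congrFun h2 j
      simp only [Pi.mul_apply, Pi.smul_apply, smul_eq_mul] at h3
      have h4 : a * monMap M v j ≠ 0 := mul_ne_zero ha (monMap_ne_zero M hv j)
      exact mul_right_cancel₀ h4 (by rw [← h3, Pi.one_apply, one_mul])
    · ext i
      have := hv i
      simp only [Pi.mul_apply, Pi.smul_apply, smul_eq_mul]
      field_simp
  · rintro ⟨c, hc, hcM, h⟩
    rw [torusPt_monMap_eq hM h]
    congr 1
    rw [monMap_mul, hcM, one_mul]

/-- The affine form of the surjectivity of `X_{dI,t} → M̄_t`; zero coordinates are allowed. -/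
theorem exists_monMap_compMatrix_eq (hrow : ∀ i, ∑ j, A i j = n) (hdet : (ratMatrix A).det ≠ 0)
    {z : Fin (n + 1) → ℂ} (hz : z 0 ^ n = ∏ i : Fin n, z i.succ) :
    ∃ y, monMap (compMatrix A) y = z := by
  have hd := (dNum_spec hdet).1
  have hm := mNum_pos hrow hdet
  have hdm := mul_mNum hrow hdet
  choose y hy using fun j : Fin n => IsAlgClosed.exists_pow_nat_eq (z j.succ) hd
  have hw : ((∏ j, y j) ^ mNum A) ^ n = z 0 ^ n := by
    rw [← pow_mul, mul_comm, hdm, hz, ← Finset.prod_pow]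
    exact Finset.prod_congr rfl fun j _ => hy j
  by_cases h0 : z 0 = 0
  · refine ⟨y, ?_⟩
    rw [h0, zero_pow (NeZero.ne n)] at hw
    rw [monMap_compMatrix, eq_zero_of_pow_eq_zero hw]
    funext j
    refine Fin.cases ?_ (fun i => ?_) j
    · simp [h0]
    · simpa using hy i
  · -- correct one coordinate by an `m`-th root of the `n`-th root of unity `z₀ / (∏ y) ^ m`
    have hP : (∏ j, y j) ^ mNum A ≠ 0 := fun h => h0 (by
      rw [h, zero_pow (NeZero.ne n)] at hw
      exact eq_zero_of_pow_eq_zero hw.symm)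
    obtain ⟨u, hu⟩ := IsAlgClosed.exists_pow_nat_eq (z 0 / (∏ j, y j) ^ mNum A) hm
    have hud : u ^ dNum A = 1 := by
      rw [← hdm, mul_comm, pow_mul, hu, div_pow, hw, div_self (pow_ne_zero _ h0)]
    refine ⟨fun j => (if j = 0 then u else 1) * y j, ?_⟩
    rw [monMap_compMatrix]
    funext j
    refine Fin.cases ?_ (fun i => ?_) j
    · simp only [Fin.cons_zero, Finset.prod_mul_distrib, Finset.prod_ite_eq', Finset.mem_univ,
        if_true, mul_pow, hu]
      exact div_mul_cancel₀ _ hP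
    · simp only [Fin.cons_succ, mul_pow, hy]
      split_ifs <;> simp [hud]

variable [NeZero (dNum A)]

/-- The kernel of the homomorphism of tori underlying `q_A ∘ φ_A`. -/
theorem monMap_compMatrix_eq_one_iff (hrow : ∀ i, ∑ j, A i j = n)
    (hdet : (ratMatrix A).det ≠ 0) {c : Fin n → ℂ} :
    monMap (compMatrix A) c = 1 ↔ ∃ a ∈ sumZero n (dNum A), c = zetaVec a := by
  have hdm := mul_mNum hrow hdet
  have key : ∀ a : Fin n → ZMod (dNum A),
      (∏ j, zetaVec a j) ^ mNum A = 1 ↔ a ∈ sumZero n (dNum A) := by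
    intro a
    rw [mem_sumZero_iff hdm, ← zetaPow_eq_one_iff, zetaPow_natCast_mul, zetaPow_sum,
      Units.ext_iff]
    simp [zetaVec]
  constructor
  · intro h
    rw [monMap_compMatrix] at h
    have h1 : ∀ i, c i ^ dNum A = 1 := fun i => by simpa using congrFun h i.succ
    have h2 : ∀ i, ∃ a : ZMod (dNum A), (zetaPow a : ℂ) = c i := fun i => by
      have hc : c i ≠ 0 := fun h0 => by
        have := h1 i
        rw [h0, zero_pow (NeZero.ne _)] at this
        exact zero_ne_one this
      obtain ⟨a, ha⟩ := exists_zetaPow_eq (u := Units.mk0 (c i) hc)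
        (Units.ext (by simpa using h1 i))
      exact ⟨a, by rw [ha, Units.val_mk0]⟩
    choose a ha using h2
    have hc : c = zetaVec a := funext fun i => (ha i).symm
    refine ⟨a, (key a).1 ?_, hc⟩
    simpa [hc] using congrFun h 0
  · rintro ⟨a, ha, rfl⟩
    rw [monMap_compMatrix]
    funext j
    refine Fin.cases ?_ (fun i => ?_) j
    · simpa using (key a).2 ha
    · have := congrArg (Units.val) (zetaPow_pow (a i))
      simpa [zetaVec] using this

end Fibres

/-! ### Density of the points with nonzero coordinates -/

/-- A hypersurface whose equation is divisible by no variable is the closure of its points with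
nonzero coordinates. By the Nullstellensatz, if `u` vanishes at those points then the equation
divides a power of `u ∏ᵢ xᵢ`, hence a power of `u`. -/
theorem dense_torus_projZeros {n : ℕ} [NeZero n] {F : MvPolynomial (Fin n) ℂ} {l : ℕ}
    (hF : F.IsHomogeneous l) (hX : ∀ i, ¬ X i ∣ F) :
    Dense {p : projZeros {F} | ∀ i, p.1.rep i ≠ 0} := by
  rw [dense_iff_inter_open]
  rintro W hW ⟨p, hpW⟩
  obtain ⟨k, u, hu, hup, H⟩ := mem_nhds_coe_iff.1 (hW.mem_nhds hpW)
  by_contra hcon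
  have hvan : ∀ v : Fin n → ℂ, eval v F = 0 → eval v (u * ∏ i, X i) = 0 := by
    intro v hv
    by_cases hT : ∀ i, v i ≠ 0
    · have hmem : torusPt v hT ∈ projZeros {F} := by
        rintro _ rfl
        exact (eval_rep_mk_eq_zero_iff hF _).2 hv
      have hu0 : eval v u = 0 := by
        by_contra hne
        exact hcon ⟨⟨_, hmem⟩, H _ fun h0 => hne ((eval_rep_mk_eq_zero_iff hu _).1 h0),
          torusPt_rep_ne_zero v hT⟩
      rw [map_mul, hu0, zero_mul]
    · obtain ⟨i, hi⟩ : ∃ i, v i = 0 := by simpa using hT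
      rw [map_mul, map_prod, Finset.prod_eq_zero (Finset.mem_univ i) (by simpa using hi), mul_zero]
  have hrad : u * ∏ i, X i ∈ (Ideal.span {F}).radical := by
    rw [← vanishingIdeal_zeroLocus_eq_radical (K := ℂ), mem_vanishingIdeal_iff]
    intro v hv
    have hev : ∀ G : MvPolynomial (Fin n) ℂ, aeval v G = eval v G :=
      RingHom.congr_fun (coe_aeval_eq_eval v)
    rw [hev]
    exact hvan v ((hev F).symm.trans (hv F (Ideal.mem_span_singleton_self F)))
  obtain ⟨N, hN⟩ := hrad
  rw [Ideal.mem_span_singleton, mul_pow] at hN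
  have hrel : IsRelPrime F ((∏ i, X i : MvPolynomial (Fin n) ℂ) ^ N) :=
    (IsRelPrime.prod_right fun i _ =>
      ((X_prime (i := i)).irreducible.isRelPrime_iff_not_dvd.2 (hX i)).symm).pow_right
  obtain ⟨w, hw⟩ := hrel.dvd_of_dvd_mul_right hN
  have h1 := congrArg (eval p.1.rep) hw
  rw [map_pow, map_mul, p.2 F rfl, zero_mul] at h1
  exact hup (eq_zero_of_pow_eq_zero h1)

section Density

variable {n : ℕ} {A : Matrix (Fin n) (Fin n) ℕ}

theorem dense_torus_varD [NeZero n] (hn : 2 ≤ n) (hrow : ∀ i, ∑ j, A i j = n)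
    (hdet : (ratMatrix A).det ≠ 0) (t : ℂ) :
    Dense {p : varD A t | ∀ i, p.1.rep i ≠ 0} := by
  refine dense_torus_projZeros (isHomogeneous_polyD hrow hdet t) fun i hi => ?_
  -- at a coordinate point other than the `i`-th the equation takes the value `1`
  have : Nontrivial (Fin n) := Fin.nontrivial_iff_two_le.2 hn
  obtain ⟨j, hj⟩ := exists_ne i
  obtain ⟨w, hw⟩ := hi
  have h := congrArg (eval (Pi.single j (1 : ℂ))) hw
  rw [map_mul, eval_X, Pi.single_eq_of_ne hj.symm, zero_mul] at h
  have h2 : ∏ k : Fin n, (Pi.single j (1 : ℂ) : Fin n → ℂ) k = 0 :=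
    Finset.prod_eq_zero (Finset.mem_univ i) (Pi.single_eq_of_ne hj.symm _)
  have h3 : ∑ k : Fin n, (Pi.single j (1 : ℂ) : Fin n → ℂ) k ^ dNum A = 1 := by
    rw [Finset.sum_eq_single j]
    · simp
    · intro k _ hk
      rw [Pi.single_eq_of_ne hk, zero_pow (dNum_spec hdet).1.ne']
    · simp
  simp [polyD, h2, h3, zero_pow (mNum_pos hrow hdet).ne'] at h

theorem nonempty_varD [NeZero n] (hn : 2 ≤ n) (hrow : ∀ i, ∑ j, A i j = n)
    (hdet : (ratMatrix A).det ≠ 0) (t : ℂ) : Nonempty (varD A t) := by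
  have hd := (dNum_spec hdet).1
  have hmd : mNum A < dNum A := by
    rw [← mul_mNum hrow hdet]
    have := mNum_pos hrow hdet
    nlinarith
  -- all coordinates but the first are `1`; the first is a root of a monic polynomial
  let P : Polynomial ℂ := Polynomial.X ^ dNum A +
    (Polynomial.C ((n : ℂ) - 1) - Polynomial.C (n * t) * Polynomial.X ^ mNum A)
  have hdeg : (Polynomial.C ((n : ℂ) - 1) -
      Polynomial.C (n * t) * Polynomial.X ^ mNum A).degree < ((dNum A : ℕ) : WithBot ℕ) := by
    refine (Polynomial.degree_sub_le _ _).trans_lt (max_lt ?_ ?_)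
    · exact Polynomial.degree_C_le.trans_lt (WithBot.coe_lt_coe.2 hd)
    · exact (Polynomial.degree_C_mul_X_pow_le _ _).trans_lt (WithBot.coe_lt_coe.2 hmd)
  have hPdeg : P.degree ≠ 0 := by
    have : P.degree = dNum A := by
      rw [← Polynomial.degree_X_pow (R := ℂ)] at hdeg
      rw [Polynomial.degree_add_eq_left_of_degree_lt hdeg, Polynomial.degree_X_pow]
    rw [this]
    exact_mod_cast hd.ne'
  obtain ⟨z, hz⟩ := IsAlgClosed.exists_root P hPdeg
  have : Nontrivial (Fin n) := Fin.nontrivial_iff_two_le.2 hn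
  obtain ⟨j, hj⟩ := exists_ne (0 : Fin n)
  let v : Fin n → ℂ := fun i => if i = 0 then z else 1
  have hv : v ≠ 0 := fun h => by simpa [v, hj] using congrFun h j
  refine ⟨⟨_, (mk_mem_varD_iff hrow hdet hv).2 ?_⟩⟩
  rw [monMap_compMatrix]
  have h1 : ∏ i, v i = z := by simp [v]
  have h2 : ∑ i, v i ^ dNum A = z ^ dNum A + (n - 1) := by
    have h : ∀ i, v i ^ dNum A = (if i = 0 then z ^ dNum A - 1 else 0) + 1 := fun i => by
      by_cases hi : i = 0 <;> simp [v, hi]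
    simp only [h, Finset.sum_add_distrib, Finset.sum_ite_eq', Finset.mem_univ, if_true]
    simp only [Finset.sum_const, Finset.card_univ, Fintype.card_fin, nsmul_eq_mul, mul_one]
    ring
  simp only [Fin.cons_zero, Fin.cons_succ, h1, h2]
  simp only [P, Polynomial.IsRoot, Polynomial.eval_add, Polynomial.eval_sub, Polynomial.eval_mul,
    Polynomial.eval_pow, Polynomial.eval_X, Polynomial.eval_C] at hz
  linear_combination hz

theorem exists_torusPt_mem_varD [NeZero n] (hn : 2 ≤ n) (hrow : ∀ i, ∑ j, A i j = n)
    (hdet : (ratMatrix A).det ≠ 0) (t : ℂ) :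
    ∃ v, ∃ hv : ∀ i, v i ≠ 0, torusPt v hv ∈ varD A t := by
  have := nonempty_varD hn hrow hdet t
  obtain ⟨p, hp⟩ := (dense_torus_varD hn hrow hdet t).nonempty
  exact ⟨p.1.rep, hp, by rw [torusPt_rep hp]; exact p.2⟩

theorem dense_torus_varA [NeZero n] (hn : 2 ≤ n) (hrow : ∀ i, ∑ j, A i j = n)
    (hcol : ∀ j, ∑ i, A i j = n) (hdet : (ratMatrix A).det ≠ 0) (t : ℂ)
    [IrreducibleSpace (varA A t)] : Dense {p : varA A t | ∀ i, p.1.rep i ≠ 0} := by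
  obtain ⟨v, hv, hmem⟩ := exists_torusPt_mem_varD hn hrow hdet t
  rw [torusPt_mem_varD_iff_varA hrow hcol hdet] at hmem
  exact isOpen_torus.dense ⟨⟨_, hmem⟩, torusPt_rep_ne_zero _ (monMap_ne_zero _ hv)⟩

theorem monMap_compMatrix_ne_zero (hdet : (ratMatrix A).det ≠ 0) {v : Fin n → ℂ} (hv : v ≠ 0) :
    monMap (compMatrix A) v ≠ 0 := fun h => hv (funext fun i => by
  have := congrFun h i.succ
  rw [monMap_compMatrix] at this
  simpa [(dNum_spec hdet).1.ne'] using this)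

/-- `M̄_t` is the image of `X_{dI,t}` under `q_A ∘ φ_A`, which extends to a morphism on all of
`X_{dI,t}`; so density is inherited from `X_{dI,t}`. -/
theorem dense_torus_mirror [NeZero n] (hn : 2 ≤ n) (hrow : ∀ i, ∑ j, A i j = n)
    (hdet : (ratMatrix A).det ≠ 0) (t : ℂ) :
    Dense {q : mirror n t | ∀ i, q.1.rep i ≠ 0} := by
  have hmem : ∀ v (hv : v ≠ 0), Projectivization.mk ℂ v hv ∈ varD A t ↔
      Projectivization.mk ℂ _ (monMap_compMatrix_ne_zero hdet hv) ∈ mirror n t := fun v hv => by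
    rw [mk_mem_varD_iff hrow hdet, mk_mem_mirror_iff]
    exact (and_iff_left (monMap_compMatrix_zero_pow hrow hdet v)).symm
  let Φ : varD A t → mirror n t := fun p =>
    ⟨Projectivization.mk ℂ _ (monMap_compMatrix_ne_zero hdet p.1.rep_nonzero),
      (hmem _ p.1.rep_nonzero).1 (by rw [Projectivization.mk_rep]; exact p.2)⟩
  have hcont : Continuous Φ := by
    refine continuous_iff_continuousAt.2 fun p W hW => ?_
    obtain ⟨k, u, hu, hup, H⟩ := mem_nhds_coe_iff.1 hW
    let g : Fin (n + 1) → MvPolynomial (Fin n) ℂ :=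
      Fin.cons ((∏ i, X i) ^ mNum A) fun i => X i ^ dNum A
    have hg : ∀ j, (g j).IsHomogeneous (dNum A) := fun j => by
      refine Fin.cases ?_ (fun i => isHomogeneous_X_pow _ _) j
      have := isHomogeneous_prod_X n (mNum A)
      rwa [mul_mNum hrow hdet] at this
    have hgv : ∀ v : Fin n → ℂ, eval v (aeval g u) = eval (monMap (compMatrix A) v) u := by
      intro v
      rw [← coe_aeval_eq_eval, ← coe_aeval_eq_eval, RingHom.coe_coe, RingHom.coe_coe,
        ← AlgHom.comp_apply, comp_aeval, monMap_compMatrix]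
      congr 2
      funext j
      refine Fin.cases ?_ (fun i => ?_) j <;> simp [g]
    have key : ∀ q : varD A t, eval (Φ q).1.rep u = 0 ↔ eval q.1.rep (aeval g u) = 0 := fun q => by
      rw [hgv]
      exact eval_rep_mk_eq_zero_iff hu _
    exact mem_nhds_coe_iff.2 ⟨_, _, hu.aeval g hg, fun h0 => hup ((key p).2 h0),
      fun q hq => H _ fun h0 => hq ((key q).1 h0)⟩
  have hsurj : Function.Surjective Φ := by
    intro q
    have hq := q.2
    rw [← q.1.mk_rep, mk_mem_mirror_iff] at hq
    obtain ⟨y, hy⟩ := exists_monMap_compMatrix_eq hrow hdet hq.2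
    have hy0 : y ≠ 0 := by
      rintro rfl
      refine q.1.rep_nonzero ?_
      rw [← hy, monMap_compMatrix]
      funext j
      refine Fin.cases ?_ (fun i => ?_) j
      · simp [(mNum_pos hrow hdet).ne', NeZero.ne n]
      · simp [(dNum_spec hdet).1.ne']
    have hyD : Projectivization.mk ℂ y hy0 ∈ varD A t := by
      rw [hmem]
      simp only [hy, Projectivization.mk_rep]
      exact q.2
    refine ⟨⟨_, hyD⟩, Subtype.ext ?_⟩
    obtain ⟨c, hc, hcr⟩ := exists_rep_eq_smul hy0
    conv_rhs => rw [← q.1.mk_rep]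
    rw [Projectivization.mk_eq_mk_iff']
    refine ⟨c ^ (dNum A : ℤ), ?_⟩
    simp only [hcr]
    rw [monMap_smul (sum_compMatrix hrow hdet) hc, hy]
  refine (hsurj.denseRange.dense_image hcont (dense_torus_varD hn hrow hdet t)).mono ?_
  rintro _ ⟨p, hp, rfl⟩
  exact torusPt_rep_ne_zero _ (monMap_ne_zero (compMatrix A) hp)

end Density

/-! ### The structure of `Γ_d` -/

theorem Gam.mk_surjective {n d : ℕ} : Function.Surjective (Gam.mk (n := n) (d := d)) := fun x => by
  obtain ⟨a, ha⟩ := QuotientAddGroup.mk_surjective x.toAdd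
  exact ⟨a, congrArg Multiplicative.ofAdd ha⟩

/-- `Γ_d ≅ μ_m × μ_d ^ (n - 2)` by `a ↦ (ζ ^ ∑ᵢ (aᵢ - a₀), (ζ ^ (aᵢ - a₀))_{i ≥ 2})`, with the
coordinates numbered from `0`. -/
theorem nonempty_gam_mulEquiv {n m d : ℕ} [NeZero d] (hn : 2 ≤ n) (hm : n * m = d) :
    Nonempty (Gam n d ≃* rootsOfUnity m ℂ × (Fin (n - 2) → rootsOfUnity d ℂ)) := by
  obtain ⟨k, rfl⟩ : ∃ k, n = k + 2 := ⟨n - 2, by omega⟩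
  change Nonempty (Gam (k + 2) d ≃* rootsOfUnity m ℂ × (Fin k → rootsOfUnity d ℂ))
  have hsum : ∀ a : Fin (k + 2) → ZMod d,
      (m : ZMod d) * ∑ i, (a i - a 0) = m * ∑ i, a i := by
    intro a
    rw [Finset.sum_sub_distrib, mul_sub, Finset.sum_const, Finset.card_univ, Fintype.card_fin,
      nsmul_eq_mul, ← mul_assoc, mul_comm (m : ZMod d) (_ : ℕ), ← Nat.cast_mul, hm,
      ZMod.natCast_self, zero_mul, sub_zero]
  let f : sumZero (k + 2) d →+ Additive (rootsOfUnity m ℂ × (Fin k → rootsOfUnity d ℂ)) :=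
    { toFun := fun a => Additive.ofMul
        (⟨zetaPow (∑ i, (a.1 i - a.1 0)), by
          rw [mem_rootsOfUnity, ← zetaPow_natCast_mul, hsum, (mem_sumZero_iff hm _).1 a.2,
            zetaPow_zero]⟩,
        fun i => ⟨zetaPow (a.1 i.succ.succ - a.1 0),
          (mem_rootsOfUnity _ _).2 (zetaPow_pow _)⟩)
      map_zero' := by
        refine Additive.toMul.injective (Prod.ext (Subtype.ext ?_)
          (funext fun i => Subtype.ext ?_)) <;> simp [zetaPow_zero]
      map_add' := fun a b => by
        refine Additive.toMul.injective (Prod.ext (Subtype.ext ?_)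
          (funext fun i => Subtype.ext ?_))
        · change zetaPow (∑ i, ((a.1 + b.1) i - (a.1 + b.1) 0)) = zetaPow _ * zetaPow _
          simp only [Pi.add_apply, ← zetaPow_add, ← Finset.sum_add_distrib, add_sub_add_comm]
        · simp [← zetaPow_add, add_sub_add_comm] }
  have hf : ∀ a : sumZero (k + 2) d,
      f a = 0 ↔ a ∈ (AddSubgroup.zmultiples (fun _ : Fin (k + 2) => (1 : ZMod d))).addSubgroupOf
        (sumZero (k + 2) d) := by
    intro a
    rw [AddSubgroup.mem_addSubgroupOf, AddSubgroup.mem_zmultiples_iff]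
    constructor
    · intro h
      have h1 : zetaPow (∑ i, (a.1 i - a.1 0)) = 1 :=
        congrArg (fun x : Additive (rootsOfUnity m ℂ × (Fin k → rootsOfUnity d ℂ)) =>
          (x.toMul.1 : ℂˣ)) h
      have h2 : ∀ i : Fin k, zetaPow (a.1 i.succ.succ - a.1 0) = 1 := fun i =>
        congrArg (fun x : Additive (rootsOfUnity m ℂ × (Fin k → rootsOfUnity d ℂ)) =>
          (x.toMul.2 i : ℂˣ)) h
      simp only [zetaPow_eq_one_iff] at h1 h2
      obtain ⟨z, hz⟩ := ZMod.intCast_surjective (a.1 0)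
      refine ⟨z, funext fun i => ?_⟩
      have hi : a.1 i - a.1 0 = 0 := by
        refine Fin.cases (sub_self _) (fun i => Fin.cases ?_ h2 i) i
        rw [Fin.sum_univ_succ, Fin.sum_univ_succ] at h1
        simpa [h2] using h1
      rw [sub_eq_zero.1 hi, ← hz]
      simp
    · rintro ⟨z, hz⟩
      have hc : ∀ i, a.1 i = z • 1 := fun i => by
        rw [← hz]
        rfl
      refine Additive.toMul.injective (Prod.ext (Subtype.ext ?_)
        (funext fun i => Subtype.ext ?_)) <;> simp [f, hc, zetaPow_zero]
  let g : Gam (k + 2) d →* rootsOfUnity m ℂ × (Fin k → rootsOfUnity d ℂ) :=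
    AddMonoidHom.toMultiplicativeLeft (QuotientAddGroup.lift _ f fun a ha => (hf a).2 ha)
  have hg : ∀ a, g (Gam.mk a) = (f a).toMul := fun a => rfl
  refine ⟨MulEquiv.ofBijective g ⟨?_, ?_⟩⟩
  · rw [injective_iff_map_eq_one]
    intro x hx
    obtain ⟨a, rfl⟩ := Gam.mk_surjective x
    rw [hg] at hx
    exact congrArg Multiplicative.ofAdd ((QuotientAddGroup.eq_zero_iff a).2
      ((hf a).1 (Additive.toMul.injective hx)))
  · rintro ⟨⟨u, hu⟩, w⟩
    rw [mem_rootsOfUnity] at hu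
    obtain ⟨s, hs⟩ := exists_zetaPow_eq (d := d) (u := u) (by
      rw [← hm, mul_comm, pow_mul, hu, one_pow])
    have hw : ∀ i, ∃ b : ZMod d, zetaPow b = (w i : ℂˣ) := fun i =>
      exists_zetaPow_eq ((mem_rootsOfUnity _ _).1 (w i).2)
    choose b hb using hw
    have hms : (m : ZMod d) * s = 0 := by
      rw [← zetaPow_eq_one_iff, zetaPow_natCast_mul, hs, hu]
    let a : Fin (k + 2) → ZMod d := Fin.cons 0 (Fin.cons (s - ∑ i, b i) b)
    have ha : ∑ i, a i = s := by simp [a, Fin.sum_univ_succ]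
    have hmem : a ∈ sumZero (k + 2) d := by rw [mem_sumZero_iff hm, ha, hms]
    have ha0 : a 0 = 0 := rfl
    refine ⟨Gam.mk ⟨a, hmem⟩, ?_⟩
    rw [hg]
    refine Prod.ext (Subtype.ext ?_) (funext fun i => Subtype.ext ?_)
    · change zetaPow (∑ i, (a i - a 0)) = u
      simp only [ha0, sub_zero, ha, hs]
    · change zetaPow (a i.succ.succ - a 0) = (w i : ℂˣ)
      rw [ha0, sub_zero, ← hb]
      rfl

/-! ### The actions of `Γ_d` and the quotient statements -/

theorem mem_coordMap {n k : ℕ} {X : Set (PSpace n)} {Y : Set (PSpace k)} {D : Set (Fin n → ℂ)}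
    {φ : (Fin n → ℂ) → (Fin k → ℂ)} {p : X} (hD : p.1.rep ∈ D) (h : φ p.1.rep ≠ 0)
    (hY : Projectivization.mk ℂ (φ p.1.rep) h ∈ Y) :
    (⟨_, hY⟩ : Y) ∈ coordMap X Y D φ p := ⟨⟨hD, h, hY⟩, rfl⟩

theorem gMap_torusPt {n d : ℕ} [NeZero n] [NeZero d] (a : Fin n → ZMod d) (v : Fin n → ℂ)
    (hv : ∀ i, v i ≠ 0) :
    gMap a (torusPt v hv) =
      torusPt (zetaVec a * v) fun i => mul_ne_zero (zetaVec_ne_zero a i) (hv i) := rfl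

theorem gMap_eq_torusPt {n d : ℕ} [NeZero n] [NeZero d] (a : Fin n → ZMod d) {p : PSpace n}
    (hp : ∀ i, p.rep i ≠ 0) :
    gMap a p =
      torusPt (zetaVec a * p.rep) fun i => mul_ne_zero (zetaVec_ne_zero a i) (hp i) := by
  rw [← gMap_torusPt a p.rep hp, torusPt_rep]

theorem gMap_rep_ne_zero {n d : ℕ} [NeZero n] [NeZero d] (a : Fin n → ZMod d) {p : PSpace n}
    (hp : ∀ i, p.rep i ≠ 0) : ∀ i, (gMap a p).rep i ≠ 0 := by
  rw [gMap_eq_torusPt a hp]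
  exact torusPt_rep_ne_zero _ _

theorem gMap_zero {n d : ℕ} [NeZero d] (p : PSpace n) : gMap (0 : Fin n → ZMod d) p = p := by
  have : (fun i : Fin n => zeta d ^ ((0 : Fin n → ZMod d) i).val) = 1 := by
    funext i
    simp
  rw [gMap, this, diagMap_one]

section Main

variable {n : ℕ} [NeZero n] {A : Matrix (Fin n) (Fin n) ℕ} {t : ℂ}

/-- `a ↦ B a` as a homomorphism. -/
noncomputable def bMulHom (A : Matrix (Fin n) (Fin n) ℕ) :
    (Fin n → ZMod (dNum A)) →+ (Fin n → ZMod (dNum A)) :=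
  (Matrix.mulVecLin ((matB A).map (fun b => (b : ZMod (dNum A))))).toAddMonoidHom

theorem bMulHom_one (hrow : ∀ i, ∑ j, A i j = n) (hdet : (ratMatrix A).det ≠ 0) :
    bMulHom A (fun _ => 1) = fun _ => (mNum A : ZMod (dNum A)) := by
  funext i
  have h := congrArg (Int.cast : ℤ → ZMod (dNum A)) (sum_matB_row hrow hdet i)
  rw [Int.cast_sum, Int.cast_natCast] at h
  rw [← h]
  simp [bMulHom, Matrix.mulVec, dotProduct]

theorem exists_mem_shiodaMap (hrow : ∀ i, ∑ j, A i j = n) (hcol : ∀ j, ∑ i, A i j = n)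
    (hdet : (ratMatrix A).det ≠ 0) (p : varD A t) (hp : ∀ i, p.1.rep i ≠ 0) :
    ∃ q ∈ shiodaMap A t p,
      q.1 = torusPt (monMap (matB A) p.1.rep) (monMap_ne_zero _ hp) := by
  have hY : torusPt (monMap (matB A) p.1.rep) (monMap_ne_zero _ hp) ∈ varA A t := by
    rw [← torusPt_mem_varD_iff_varA hrow hcol hdet _ hp, torusPt_rep hp]
    exact p.2
  exact ⟨_, mem_coordMap (p := p) (D := {y | ∀ k, y k ≠ 0}) (φ := monMap (matB A)) hp _ hY, rfl⟩

theorem exists_mem_mirrorMap (hrow : ∀ i, ∑ j, A i j = n) (hcol : ∀ j, ∑ i, A i j = n)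
    (p : varA A t) (hp : ∀ i, p.1.rep i ≠ 0) :
    ∃ q ∈ mirrorMap A t p,
      q.1 = torusPt (monMap (extMatrix A) p.1.rep) (monMap_ne_zero _ hp) := by
  have hY : torusPt (monMap (extMatrix A) p.1.rep) (monMap_ne_zero _ hp) ∈ mirror n t := by
    rw [← torusPt_mem_varA_iff hrow hcol _ hp, torusPt_rep hp]
    exact p.2
  have hmap : mirrorMap A t =
      coordMap (varA A t) (mirror n t) Set.univ (monMap (extMatrix A)) := by
    rw [mirrorMap]
    congr 1
    exact (funext monMap_extMatrix).symm
  rw [hmap]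
  exact ⟨_, mem_coordMap (Set.mem_univ _) _ hY, rfl⟩

theorem exists_torusPt_monMap_compMatrix_eq (hrow : ∀ i, ∑ j, A i j = n)
    (hdet : (ratMatrix A).det ≠ 0) (q : mirror n t) (hq : ∀ i, q.1.rep i ≠ 0) :
    ∃ v, ∃ hv : ∀ i, v i ≠ 0,
      torusPt (monMap (compMatrix A) v) (monMap_ne_zero _ hv) = q.1 := by
  have hd := (dNum_spec hdet).1.ne'
  have hq2 := q.2
  rw [← q.1.mk_rep, mk_mem_mirror_iff] at hq2
  obtain ⟨y, hy⟩ := exists_monMap_compMatrix_eq hrow hdet hq2.2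
  have hy0 : ∀ i, y i ≠ 0 := fun i h0 => hq i.succ (by
    rw [← hy, monMap_compMatrix, Fin.cons_succ, h0, zero_pow hd])
  refine ⟨y, hy0, ?_⟩
  simp only [hy]
  exact torusPt_rep hq

variable [NeZero (dNum A)]

theorem zetaPow_mem_diagStab_varD (hrow : ∀ i, ∑ j, A i j = n) (hdet : (ratMatrix A).det ≠ 0)
    {a : Fin n → ZMod (dNum A)} (ha : a ∈ sumZero n (dNum A)) :
    (fun i => zetaPow (a i)) ∈ diagStab (varD A t) := by
  intro p
  induction p using Projectivization.ind with
  | h v hv =>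
    rw [diagMap_mk, mk_mem_varD_iff hrow hdet, mk_mem_varD_iff hrow hdet]
    have : monMap (compMatrix A) (zetaVec a * v) = monMap (compMatrix A) v := by
      rw [monMap_mul, (monMap_compMatrix_eq_one_iff hrow hdet).2 ⟨a, ha, rfl⟩, one_mul]
    rw [← this]
    rfl

/-- The kernel of the homomorphism of tori underlying `q_A`. -/
theorem monMap_extMatrix_eq_one_iff (hrow : ∀ i, ∑ j, A i j = n) (hcol : ∀ j, ∑ i, A i j = n)
    (hdet : (ratMatrix A).det ≠ 0) {c : Fin n → ℂ} (hc : ∀ i, c i ≠ 0) :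
    monMap (extMatrix A) c = 1 ↔ ∃ a ∈ sumZero n (dNum A), c = zetaVec (bMul A a) := by
  constructor
  · intro h
    obtain ⟨u, hu, rfl⟩ := exists_monMap_matB_eq hdet hc
    rw [monMap_extMatrix_matB hrow hcol hdet hu] at h
    obtain ⟨a, ha, rfl⟩ := (monMap_compMatrix_eq_one_iff hrow hdet).1 h
    exact ⟨a, ha, monMap_matB_zetaVec a⟩
  · rintro ⟨a, ha, rfl⟩
    rw [← monMap_matB_zetaVec, monMap_extMatrix_matB hrow hcol hdet (zetaVec_ne_zero a)]
    exact (monMap_compMatrix_eq_one_iff hrow hdet).2 ⟨a, ha, rfl⟩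

theorem zetaPow_mem_diagStab_varA (hrow : ∀ i, ∑ j, A i j = n) (hcol : ∀ j, ∑ i, A i j = n)
    (hdet : (ratMatrix A).det ≠ 0) {a : Fin n → ZMod (dNum A)} (ha : a ∈ sumZero n (dNum A)) :
    (fun i => zetaPow (bMul A a i)) ∈ diagStab (varA A t) := by
  intro p
  induction p using Projectivization.ind with
  | h v hv =>
    rw [diagMap_mk, mk_mem_varA_iff hrow, mk_mem_varA_iff hrow]
    have : monMap (extMatrix A) (zetaVec (bMul A a) * v) = monMap (extMatrix A) v := by
      rw [monMap_mul, (monMap_extMatrix_eq_one_iff hrow hcol hdet (zetaVec_ne_zero _)).2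
        ⟨a, ha, rfl⟩, one_mul]
    rw [← this]
    rfl

/-- The kernel of the homomorphism of tori underlying `φ_A`. -/
theorem monMap_matB_eq_one_iff (hrow : ∀ i, ∑ j, A i j = n) (hcol : ∀ j, ∑ i, A i j = n)
    (hdet : (ratMatrix A).det ≠ 0) {c : Fin n → ℂ} (hc : ∀ i, c i ≠ 0) :
    monMap (matB A) c = 1 ↔ ∃ a ∈ sumZero n (dNum A), bMul A a = 0 ∧ c = zetaVec a := by
  constructor
  · intro h
    have h1 : monMap (compMatrix A) c = 1 := by
      rw [← monMap_extMatrix_matB hrow hcol hdet hc, h]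
      funext j
      simp [monMap, mon]
    obtain ⟨a, ha, rfl⟩ := (monMap_compMatrix_eq_one_iff hrow hdet).1 h1
    refine ⟨a, ha, funext fun i => zetaPow_eq_one_iff.1 (Units.ext ?_), rfl⟩
    rw [monMap_matB_zetaVec] at h
    exact congrFun h i
  · rintro ⟨a, -, h, rfl⟩
    rw [monMap_matB_zetaVec, h]
    funext i
    simp [zetaVec, zetaPow_zero]

theorem injective_of_gMap (hn : 2 ≤ n) (hrow : ∀ i, ∑ j, A i j = n)
    (hdet : (ratMatrix A).det ≠ 0) {α : Gam n (dNum A) →* Aut (varD A t)}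
    (hα : ∀ (a : sumZero n (dNum A)) (p : varD A t),
      (((α (Gam.mk a)).1 p : varD A t) : PSpace n) = gMap a.1 p) :
    Function.Injective α := by
  -- compare the coordinates of a point of `X_{dI,t}` without zero coordinates
  obtain ⟨v₀, hv₀, hv₀D⟩ := exists_torusPt_mem_varD hn hrow hdet t
  rw [injective_iff_map_eq_one]
  intro x hx
  obtain ⟨a, rfl⟩ := Gam.mk_surjective x
  have h := hα a ⟨_, hv₀D⟩
  rw [hx] at h
  obtain ⟨c, -, hc⟩ := (torusPt_eq_iff (hv := hv₀)).1 (h.trans (gMap_torusPt a.1 v₀ hv₀))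
  have hc' : ∀ i, (zetaPow (a.1 i) : ℂ) = c := fun i =>
    mul_right_cancel₀ (hv₀ i) (congrFun hc i)
  obtain ⟨z, hz⟩ := ZMod.intCast_surjective (a.1 0)
  refine congrArg Multiplicative.ofAdd ((QuotientAddGroup.eq_zero_iff a).2
    (AddSubgroup.mem_addSubgroupOf.2 (AddSubgroup.mem_zmultiples_iff.2 ⟨z, funext fun i => ?_⟩)))
  rw [zetaPow_injective (Units.ext ((hc' i).trans (hc' 0).symm)), ← hz]
  simp

theorem birationalToQuotient_shiodaMap (hn : 2 ≤ n) (hrow : ∀ i, ∑ j, A i j = n)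
    (hcol : ∀ j, ∑ i, A i j = n) (hdet : (ratMatrix A).det ≠ 0)
    [IrreducibleSpace (varA A t)] {α : Gam n (dNum A) →* Aut (varD A t)}
    (hα : ∀ (a : sumZero n (dNum A)) (p : varD A t),
      (((α (Gam.mk a)).1 p : varD A t) : PSpace n) = gMap a.1 p)
    {ρ : Gam n (dNum A) →* Aut (varA A t)}
    (hρ : ∀ (a : sumZero n (dNum A)) (p : varA A t),
      (((ρ (Gam.mk a)).1 p : varA A t) : PSpace n) = gMap (bMul A a.1) p) :
    BirationalToQuotient (shiodaMap A t) (ρ.ker.map α) := by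
  have hm0 := (mNum_pos hrow hdet).ne'
  refine birationalToQuotient_monMap _ _ (matB A) (s := mNum A) (by exact_mod_cast hm0)
    (sum_matB_row hrow hdet)
    (dense_torus_varD hn hrow hdet t) (dense_torus_varA hn hrow hcol hdet t)
    (torusPt_mem_varD_iff_varA hrow hcol hdet)
    (exists_mem_shiodaMap hrow hcol hdet) ?_ ?_ ?_
  · intro q hq
    obtain ⟨y, hy, h⟩ := exists_monMap_matB_eq hdet hq
    refine ⟨y, hy, ?_⟩
    simp only [h]
    exact torusPt_rep hq
  · rintro _ ⟨x, -, rfl⟩ p hp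
    obtain ⟨a, rfl⟩ := Gam.mk_surjective x
    rw [hα]
    exact gMap_rep_ne_zero _ hp
  · intro p p' hp hp'
    rw [torusPt_monMap_eq_iff hm0 (sum_matB_row hrow hdet) hp hp']
    constructor
    · rintro ⟨c, hc, hcM, h⟩
      obtain ⟨a, ha, hBa, rfl⟩ := (monMap_matB_eq_one_iff hrow hcol hdet hc).1 hcM
      refine ⟨_, ⟨Gam.mk ⟨a, ha⟩, ?_, rfl⟩, Subtype.ext ?_⟩
      · refine Subtype.ext (Equiv.ext fun q => Subtype.ext ?_)
        rw [hρ, hBa, gMap_zero]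
        rfl
      · rw [hα, gMap_eq_torusPt _ hp, ← h, torusPt_rep]
    · rintro ⟨_, ⟨x, hx, rfl⟩, h⟩
      obtain ⟨a, rfl⟩ := Gam.mk_surjective x
      have hp'eq : p'.1 = torusPt (zetaVec a.1 * p.1.rep)
          fun i => mul_ne_zero (zetaVec_ne_zero a.1 i) (hp i) := by
        rw [← gMap_eq_torusPt _ hp, ← hα a p, h]
      rw [← torusPt_monMap_eq_iff hm0 (sum_matB_row hrow hdet) hp hp']
      have h2 : torusPt (monMap (matB A) p'.1.rep) (monMap_ne_zero _ hp') =
          torusPt (monMap (matB A) (zetaVec a.1 * p.1.rep)) (monMap_ne_zero _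
            fun i => mul_ne_zero (zetaVec_ne_zero a.1 i) (hp i)) :=
        torusPt_monMap_eq (sum_matB_row hrow hdet) ((torusPt_rep hp').trans hp'eq)
      obtain ⟨q, -, hq⟩ := exists_mem_shiodaMap hrow hcol hdet p hp
      -- `ρ a` fixes the image of `p`
      have h3 := hρ a q
      rw [show ρ (Gam.mk a) = 1 from hx] at h3
      rw [h2, ← hq]
      refine h3.trans ?_
      rw [hq, gMap_torusPt]
      simp only [monMap_mul, monMap_matB_zetaVec]

theorem birationalToQuotient_mirrorMap (hn : 2 ≤ n) (hrow : ∀ i, ∑ j, A i j = n)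
    (hcol : ∀ j, ∑ i, A i j = n) (hdet : (ratMatrix A).det ≠ 0)
    [IrreducibleSpace (varA A t)] {ρ : Gam n (dNum A) →* Aut (varA A t)}
    (hρ : ∀ (a : sumZero n (dNum A)) (p : varA A t),
      (((ρ (Gam.mk a)).1 p : varA A t) : PSpace n) = gMap (bMul A a.1) p) :
    BirationalToQuotient (mirrorMap A t) ρ.range := by
  obtain ⟨v₀, hv₀, hv₀D⟩ := exists_torusPt_mem_varD hn hrow hdet t
  have : Nonempty (mirror n t) := ⟨⟨_, (torusPt_mem_varD_iff hrow hdet v₀ hv₀).1 hv₀D⟩⟩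
  refine birationalToQuotient_monMap _ _ (extMatrix A) (s := n)
    (by exact_mod_cast NeZero.ne n) (sum_extMatrix hrow)
    (dense_torus_varA hn hrow hcol hdet t) (dense_torus_mirror hn hrow hdet t)
    (torusPt_mem_varA_iff hrow hcol)
    (exists_mem_mirrorMap hrow hcol) ?_ ?_ ?_
  · intro q hq
    obtain ⟨v, hv, h⟩ := exists_torusPt_monMap_compMatrix_eq hrow hdet q hq
    refine ⟨monMap (matB A) v, monMap_ne_zero _ hv, ?_⟩
    simp only [monMap_extMatrix_matB hrow hcol hdet hv, h]
  · rintro _ ⟨x, rfl⟩ p hp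
    obtain ⟨a, rfl⟩ := Gam.mk_surjective x
    rw [hρ]
    exact gMap_rep_ne_zero _ hp
  · intro p p' hp hp'
    rw [torusPt_monMap_eq_iff (NeZero.ne n) (sum_extMatrix hrow) hp hp']
    constructor
    · rintro ⟨c, hc, hcM, h⟩
      obtain ⟨a, ha, rfl⟩ := (monMap_extMatrix_eq_one_iff hrow hcol hdet hc).1 hcM
      refine ⟨_, ⟨Gam.mk ⟨a, ha⟩, rfl⟩, Subtype.ext ?_⟩
      rw [hρ, gMap_eq_torusPt _ hp, ← h, torusPt_rep]
    · rintro ⟨_, ⟨x, rfl⟩, h⟩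
      obtain ⟨a, rfl⟩ := Gam.mk_surjective x
      refine ⟨zetaVec (bMul A a.1), zetaVec_ne_zero _,
        (monMap_extMatrix_eq_one_iff hrow hcol hdet (zetaVec_ne_zero _)).2 ⟨a.1, a.2, rfl⟩, ?_⟩
      rw [torusPt_rep, ← gMap_eq_torusPt _ hp, ← hρ a p, h]

theorem birationalToQuotient_comp (hn : 2 ≤ n) (hrow : ∀ i, ∑ j, A i j = n)
    (hcol : ∀ j, ∑ i, A i j = n) (hdet : (ratMatrix A).det ≠ 0)
    {α : Gam n (dNum A) →* Aut (varD A t)}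
    (hα : ∀ (a : sumZero n (dNum A)) (p : varD A t),
      (((α (Gam.mk a)).1 p : varD A t) : PSpace n) = gMap a.1 p) :
    BirationalToQuotient ((mirrorMap A t).comp (shiodaMap A t)) α.range := by
  obtain ⟨v₀, hv₀, hv₀D⟩ := exists_torusPt_mem_varD hn hrow hdet t
  have : Nonempty (mirror n t) := ⟨⟨_, (torusPt_mem_varD_iff hrow hdet v₀ hv₀).1 hv₀D⟩⟩
  refine birationalToQuotient_monMap _ _ (compMatrix A) (s := dNum A)
    (by exact_mod_cast NeZero.ne (dNum A)) (sum_compMatrix hrow hdet)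
    (dense_torus_varD hn hrow hdet t) (dense_torus_mirror hn hrow hdet t)
    (torusPt_mem_varD_iff hrow hdet) ?_ (exists_torusPt_monMap_compMatrix_eq hrow hdet) ?_ ?_
  · intro p hp
    obtain ⟨q, hq, hqe⟩ := exists_mem_shiodaMap hrow hcol hdet p hp
    have hqT : ∀ i, q.1.rep i ≠ 0 := by
      rw [hqe]
      exact torusPt_rep_ne_zero _ _
    obtain ⟨r, hr, hre⟩ := exists_mem_mirrorMap hrow hcol q hqT
    refine ⟨r, Part.mem_bind hq hr, ?_⟩
    rw [hre]
    refine (torusPt_monMap_eq (sum_extMatrix hrow) (hw := monMap_ne_zero _ hp)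
      ((torusPt_rep hqT).trans hqe)).trans ?_
    simp only [monMap_extMatrix_matB hrow hcol hdet hp]
  · rintro _ ⟨x, rfl⟩ p hp
    obtain ⟨a, rfl⟩ := Gam.mk_surjective x
    rw [hα]
    exact gMap_rep_ne_zero _ hp
  · intro p p' hp hp'
    rw [torusPt_monMap_eq_iff (NeZero.ne (dNum A)) (sum_compMatrix hrow hdet) hp hp']
    constructor
    · rintro ⟨c, hc, hcM, h⟩
      obtain ⟨a, ha, rfl⟩ := (monMap_compMatrix_eq_one_iff hrow hdet).1 hcM
      refine ⟨_, ⟨Gam.mk ⟨a, ha⟩, rfl⟩, Subtype.ext ?_⟩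
      rw [hα, gMap_eq_torusPt _ hp, ← h, torusPt_rep]
    · rintro ⟨_, ⟨x, rfl⟩, h⟩
      obtain ⟨a, rfl⟩ := Gam.mk_surjective x
      refine ⟨zetaVec a.1, zetaVec_ne_zero _,
        (monMap_compMatrix_eq_one_iff hrow hdet).2 ⟨a.1, a.2, rfl⟩, ?_⟩
      rw [torusPt_rep, ← gMap_eq_torusPt _ hp, ← hα a p, h]

end Main

end Shioda

theorem theorem2p6 (n : ℕ) (hn : 2 ≤ n) (A : Matrix (Fin n) (Fin n) ℕ)
    (hrow : ∀ i, ∑ j, A i j = n) (hcol : ∀ j, ∑ i, A i j = n)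
    (hdet : (Shioda.ratMatrix A).det ≠ 0) (t : ℂ)
    (hirr : IrreducibleSpace (Shioda.varA A t)) :
    (∃ (α : Shioda.Gam n (Shioda.dNum A) →* Aut (Shioda.varD A t))
       (ρ : Shioda.Gam n (Shioda.dNum A) →* Aut (Shioda.varA A t)),
      -- `α` is the action of `Γ_d` on `X_{dI,t}`, and it is faithful
      (∀ a (p : Shioda.varD A t),
        (((α (Shioda.Gam.mk a)).1 p : Shioda.varD A t) : PSpace n) = Shioda.gMap a.1 p) ∧
      Function.Injective α ∧
      -- `ρ` is the homomorphism `g_a ↦ g_{Ba}`; `Γ_A` is its kernel and `H_A` its image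
      (∀ a (p : Shioda.varA A t),
        (((ρ (Shioda.Gam.mk a)).1 p : Shioda.varA A t) : PSpace n) =
          Shioda.gMap (Shioda.bMul A a.1) p) ∧
      BirationalToQuotient (Shioda.shiodaMap A t) (ρ.ker.map α) ∧
      BirationalToQuotient (Shioda.mirrorMap A t) ρ.range ∧
      Nonempty (ρ.range ≃* Shioda.Gam n (Shioda.dNum A) ⧸ ρ.ker) ∧
      BirationalToQuotient ((Shioda.mirrorMap A t).comp (Shioda.shiodaMap A t)) α.range) ∧
    Nonempty (Shioda.Gam n (Shioda.dNum A) ≃*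
      rootsOfUnity (Shioda.mNum A) ℂ × (Fin (n - 2) → rootsOfUnity (Shioda.dNum A) ℂ)) := by
  have : NeZero n := ⟨by omega⟩
  have : NeZero (Shioda.dNum A) := ⟨(Shioda.dNum_spec hdet).1.ne'⟩
  refine ⟨?_, Shioda.nonempty_gam_mulEquiv hn (Shioda.mul_mNum hrow hdet)⟩
  obtain ⟨α, hα⟩ := Shioda.exists_gamHom (X := Shioda.varD A t) (AddMonoidHom.id _)
    (fun a ha => Shioda.zetaPow_mem_diagStab_varD hrow hdet ha) ⟨1, rfl⟩
  obtain ⟨ρ, hρ⟩ := Shioda.exists_gamHom (X := Shioda.varA A t) (Shioda.bMulHom A)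
    (fun a ha => Shioda.zetaPow_mem_diagStab_varA hrow hcol hdet ha)
    ⟨_, Shioda.bMulHom_one hrow hdet⟩
  exact ⟨α, ρ, hα, Shioda.injective_of_gMap hn hrow hdet hα, hρ,
    Shioda.birationalToQuotient_shiodaMap hn hrow hcol hdet hα hρ,
    Shioda.birationalToQuotient_mirrorMap hn hrow hcol hdet hρ,
    ⟨(QuotientGroup.quotientKerEquivRange ρ).symm⟩,
    Shioda.birationalToQuotient_comp hn hrow hcol hdet hα⟩
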